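/- \textbf{Notation.} For a set $\Lambda$, finite sequences in $\Lambda$ are ordered by $s\preceq t$ if $s$ is an initial segment of $t$ and $s\prec t$ if moreover $s\ne t$; $s^\frown t$ is concatenation, and for a set $U$ of finite sequences $MAX(U)$ is the set of $\prec$-maximal members of $U$. For an ordinal $a$ and a sequence $t=(\xi_i)_{i=1}^n$ of ordinals, $a+t=(a+\xi_i)_{i=1}^n$. Put $\Pi T=\{(s,t)\in T\times MAX(T): s\preceq t\}$. \textbf{Trees.} $\Gamma_0=\{(0)\}$. Given $\Gamma_\xi$, let $\Gamma_{\xi,1}=\Gamma_\xi$, $$\Gamma_{\xi,n+1}=\{\omega^\xi n+s: s\in\Gamma_\xi\}\cup\{(\omega^\xi n+t)^\frown u: t\in MAX(\Gamma_\xi),\ u\in\Gamma_{\xi,n}\},$$ and $\Gamma_{\xi+1}=\bigcup_{n\ge1}\Gamma_{\xi,n}$. For a limit ordinal $\xi$, $\Gamma_\xi=\bigcup_{\zeta<\xi}(\omega^\zeta+\Gamma_{\zeta+1})$. \textbf{Weights.} Define $p_\xi:\Pi\Gamma_\xi\to[0,1]$ by $p_0((0),(0))=1$; if $t=(\omega^\xi(n-1)+t_1)^\frown\cdots^\frown(\omega^\xi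 0+t_n)$ with $t_1,\dots,t_n\in MAX(\Gamma_\xi)$ and $s=(\omega^\xi(n-1)+t_1)^\frown\cdots^\frown(\omega^\xi(n-m+1)+t_{m-1})^\frown(\omega^\xi(n-m)+s')$ with $1\le m\le n$ and $\varnothing\prec s'\preceq t_m$, then $p_{\xi+1}(s,t)=\frac1n p_\xi(s',t_m)$; and if $\xi$ is a limit, $\zeta<\xi$ and $(s',t')\in\Pi\Gamma_{\zeta+1}$, then $p_\xi(\omega^\zeta+s',\omega^\zeta+t')=p_{\zeta+1}(s',t')$. The value $p_\xi(s,t)$ does not depend on the maximal extension $t$ of $s$, and $\mathbb P_\xi(s)$ denotes it. Let $D$ be a directed set and let $\Omega_\xi=\Gamma_\xi D$ be the set of finite sequences $\tau=((\xi_i,U_i))_{i=1}^n$ in pairs of an ordinal and a member of $D$ such that $t=(\xi_i)_{i=1}^n\in\Gamma_\xi$; put $\mathbb P_\xi(\tau)=\mathbb P_\xi(t)$. \textbf{Prunings.} An \emph{extended pruning} $(\theta,e):\Omega_\xi\to\Omega_\xi$ is a pair of maps $\theta:\Omega_\xi\to\Omega_\xi$, $e:MAX(\Omega_\xi)\to MAX(\Omega_\xi)$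 such that $\tau\prec\tau'$ implies $\theta(\tau)\prec\theta(\tau')$; if $U$ and $V$ are the last $D$-coordinates of $\tau$ and $\theta(\tau)$, then $U\le_D V$; and $\theta(\tau)\preceq e(\tau)$ for all $\tau\in MAX(\Omega_\xi)$. For $\varepsilon\in\mathbb R$, a function $g:\Pi\Omega_\xi\to\mathbb R$ is \emph{$\varepsilon$-small} if there is an extended pruning $(\theta,e):\Omega_\xi\to\Omega_\xi$ such that $\sum_{\varnothing\prec\tau'\preceq e(\tau)}\mathbb P_\xi(\tau')g(\tau',e(\tau))<\varepsilon$ for every $\tau\in MAX(\Omega_\xi)$. It is \emph{$\varepsilon$-large} if for every $\delta>0$ there is an extended pruning $(\theta,e):\Omega_\xi\to\Omega_\xi$ such that $g(\theta(\tau'),e(\tau))\ge\varepsilon-\delta$ for every $(\tau',\tau)\in\Pi\Omega_\xi$. \textbf{Theorem.} Let $\xi$ be any ordinal and $D$ any directed set. (1) For every $g:\Pi\Omega_\xi\to[-1,1]$ and every $\varepsilon\in\mathbb R$, $g$ is $\varepsilon$-large or $\varepsilon$-small (or both). (2) If $g:\Pi\Omega_\xi\to\mathbb R$ is bounded and $\varepsilon\in\mathbb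 R$ is such that $\sum_{\varnothing\prec\tau'\preceq\tau}\mathbb P_\xi(\tau')g(\tau',\tau)\ge\varepsilon$ for every $\tau\in MAX(\Omega_\xi)$, then $g$ is $\varepsilon$-large. -/

import Mathlib

universe u v

namespace OrdTree

/-! Finite sequences are lists, `s ⪯ t` (initial segment) is `s <+: t`, concatenation is `++`. -/

/-- `MAX(U)`: the members of `U` that are maximal in `U` for the initial segment order. -/
def maxElts {α : Type*} (U : Set (List α)) : Set (List α) :=
  {t | t ∈ U ∧ ∀ s ∈ U, t <+: s → s = t}

/-- A `B`-tree: a set of nonempty finite sequences closed under nonempty initial segments. -/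
def IsBTree {α : Type*} (T : Set (List α)) : Prop :=
  [] ∉ T ∧ ∀ t ∈ T, ∀ s, s ≠ [] → s <+: t → s ∈ T

/-- `Π T = {(s, t) ∈ T × MAX(T) : s ⪯ t}`. -/
def branchPairs {α : Type*} (T : Set (List α)) : Set (List α × List α) :=
  {q | q.1 ∈ T ∧ q.2 ∈ maxElts T ∧ q.1 <+: q.2}

/-- `a + t = (a + t_1, …, a + t_n)`. -/
noncomputable def shift (a : Ordinal.{u}) (t : List Ordinal.{u}) : List Ordinal.{u} :=
  t.map (fun x => a + x)

/-- The trees `Γ_{ξ,n}` built from `G = Γ_ξ`, with the convention `Γ_{ξ,0} = ∅`: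
`Γ_{ξ,n+1} = {ω^ξ n + s : s ∈ G} ∪ {(ω^ξ n + t) ⌢ u : t ∈ MAX(G), u ∈ Γ_{ξ,n}}`. -/
def gammaLevel (ξ : Ordinal.{u}) (G : Set (List Ordinal.{u})) : ℕ → Set (List Ordinal.{u})
  | 0 => ∅
  | n + 1 =>
      {r | ∃ s ∈ G, r = shift (Ordinal.omega0 ^ ξ * n) s} ∪
      {r | ∃ t ∈ maxElts G, ∃ u ∈ gammaLevel ξ G n, r = shift (Ordinal.omega0 ^ ξ * n) t ++ u}

/-- The trees `Γ_ξ`: `Γ_0 = {(0)}`, `Γ_{ξ+1} = ⋃_n Γ_{ξ,n}`, and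
`Γ_ξ = ⋃_{ζ<ξ} (ω^ζ + Γ_{ζ+1})` for limit `ξ`. -/
noncomputable def Gam (ξ : Ordinal.{u}) : Set (List Ordinal.{u}) :=
  Ordinal.limitRecOn (motive := fun _ => Set (List Ordinal.{u})) ξ
    {[0]}
    (fun ξ G => ⋃ n : ℕ, gammaLevel ξ G n)
    (fun _ hξ G => ⋃ ζ, ⋃ hζ, shift (Ordinal.omega0 ^ ζ) '' G (ζ + 1) (hξ.add_one_lt hζ))

theorem Gam_zero : Gam.{u} 0 = {[0]} := by simp [Gam]

theorem Gam_add_one (ξ : Ordinal.{u}) :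
    Gam (ξ + 1) = ⋃ n : ℕ, gammaLevel ξ (Gam ξ) n := by
  simp only [Gam, Ordinal.limitRecOn_add_one]

theorem Gam_limit {ξ : Ordinal.{u}} (hξ : Order.IsSuccLimit ξ) :
    Gam ξ = ⋃ ζ, ⋃ _ : ζ < ξ, shift (Ordinal.omega0 ^ ζ) '' Gam (ζ + 1) := by
  simp only [Gam, Ordinal.limitRecOn_limit _ _ _ _ hξ]

theorem gammaLevel_one (ξ : Ordinal.{u}) (G : Set (List Ordinal.{u})) :
    gammaLevel ξ G 1 = G := by
  simp [gammaLevel, shift]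

theorem isBTree_gammaLevel {ξ : Ordinal.{u}} {G : Set (List Ordinal.{u})} (hG : IsBTree G) (n : ℕ) :
    IsBTree (gammaLevel ξ G n) := by
  induction n with
  | zero => simp [gammaLevel, IsBTree]
  | succ n ih =>
    have key : ∀ t ∈ G, ∀ s, s ≠ [] → s <+: shift (Ordinal.omega0 ^ ξ * n) t →
        s ∈ gammaLevel ξ G (n + 1) := by
      intro t ht s hs hst
      obtain ⟨s', hs', rfl⟩ := List.prefix_map_iff.1 hst
      exact Or.inl ⟨s', hG.2 t ht s' (by rintro rfl; simp at hs) hs', rfl⟩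
    refine ⟨?_, ?_⟩
    · rintro (⟨s, hs, h⟩ | ⟨t, ht, u, hu, h⟩)
      · have : s = [] := by simpa [shift] using h.symm
        exact hG.1 (this ▸ hs)
      · have : u = [] := (List.append_eq_nil_iff.1 h.symm).2
        exact ih.1 (this ▸ hu)
    · rintro r (⟨t, ht, rfl⟩ | ⟨t, ht, u, hu, rfl⟩) s hs hst
      · exact key t ht s hs hst
      · rcases List.prefix_or_prefix_of_prefix hst (List.prefix_append _ u) with h | ⟨s', rfl⟩
        · exact key t ht.1 s hs h
        · have hs' : s' <+: u := (List.prefix_append_right_inj _).1 hst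
          rcases eq_or_ne s' [] with rfl | hne
          · exact key t ht.1 _ hs (by simp)
          · exact Or.inr ⟨t, ht, s', ih.2 u hu s' hne hs', rfl⟩

theorem isBTree_Gam (ξ : Ordinal.{u}) : IsBTree (Gam ξ) := by
  induction ξ using Ordinal.limitRecOn with
  | zero =>
    rw [Gam_zero]
    refine ⟨by simp, ?_⟩
    rintro t rfl s hs hst
    rcases s with _ | ⟨a, s⟩
    · exact absurd rfl hs
    · simpa [List.cons_prefix_cons] using hst
  | add_one ζ ih =>
    rw [Gam_add_one]
    have h := fun n => isBTree_gammaLevel (ξ := ζ) ih n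
    refine ⟨by simpa using fun n => (h n).1, ?_⟩
    intro t ht s hs hst
    obtain ⟨n, hn⟩ := Set.mem_iUnion.1 ht
    exact Set.mem_iUnion.2 ⟨n, (h n).2 t hn s hs hst⟩
  | limit ξ hξ ih =>
    rw [Gam_limit hξ]
    refine ⟨?_, ?_⟩
    · simp only [Set.mem_iUnion, not_exists]
      rintro ζ hζ ⟨t, ht, h⟩
      have : t = [] := by simpa [shift] using h
      exact (ih _ (hξ.add_one_lt hζ)).1 (this ▸ ht)
    · simp only [Set.mem_iUnion]
      rintro _ ⟨ζ, hζ, t, ht, rfl⟩ s hs hst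
      obtain ⟨s', hs', rfl⟩ := List.prefix_map_iff.1 hst
      exact ⟨ζ, hζ, s', (ih _ (hξ.add_one_lt hζ)).2 t ht s' (by rintro rfl; simp at hs) hs', rfl⟩

/-- `levelConcat ξ n [t_1, …, t_m] = (ω^ξ(n-1) + t_1) ⌢ (ω^ξ(n-2) + t_2) ⌢ … ⌢ (ω^ξ(n-m) + t_m)`,
meant for `m ≤ n`. -/
noncomputable def levelConcat (ξ : Ordinal.{u}) : ℕ → List (List Ordinal.{u}) → List Ordinal.{u}
  | _, [] => []
  | 0, _ :: _ => []
  | n + 1, t :: ts => shift (Ordinal.omega0 ^ ξ * n) t ++ levelConcat ξ n ts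

/-- `HasWeight ξ s t w` says that `(s, t) ∈ Π Γ_ξ` and `p_ξ(s, t) = w`, where:
* `p_0((0), (0)) = 1`;
* if `t = (ω^ξ(n-1) + t_1) ⌢ … ⌢ t_n` with `t_1, …, t_n ∈ MAX(Γ_ξ)` and
  `s = (ω^ξ(n-1) + t_1) ⌢ … ⌢ (ω^ξ(n-m+1) + t_{m-1}) ⌢ (ω^ξ(n-m) + s')` with
  `∅ ≠ s' ⪯ t_m`, then `p_{ξ+1}(s, t) = p_ξ(s', t_m) / n`;
  here `l` is `[t_1, …, t_{m-1}]`, `t'` is `t_m` and `r` is `[t_{m+1}, …, t_n]`;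
* for `ξ` a limit, `ζ < ξ` and `(s', t') ∈ Π Γ_{ζ+1}`,
  `p_ξ(ω^ζ + s', ω^ζ + t') = p_{ζ+1}(s', t')`. -/
inductive HasWeight : Ordinal.{u} → List Ordinal.{u} → List Ordinal.{u} → ℝ → Prop
  | zero : HasWeight 0 [0] [0] 1
  | add_one (ξ : Ordinal.{u}) (l : List (List Ordinal.{u})) (t' : List Ordinal.{u})
      (r : List (List Ordinal.{u})) (n : ℕ) (s' : List Ordinal.{u}) (w : ℝ)
      (hn : n = (l ++ t' :: r).length)
      (hmax : ∀ x ∈ l ++ t' :: r, x ∈ maxElts (Gam ξ))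
      (hw : HasWeight ξ s' t' w) :
      HasWeight (ξ + 1) (levelConcat ξ n (l ++ [s'])) (levelConcat ξ n (l ++ t' :: r)) (w / n)
  | limit (ξ ζ : Ordinal.{u}) (s' t' : List Ordinal.{u}) (w : ℝ)
      (hξ : Order.IsSuccLimit ξ) (hζ : ζ < ξ) (hw : HasWeight (ζ + 1) s' t' w) :
      HasWeight ξ (shift (Ordinal.omega0 ^ ζ) s') (shift (Ordinal.omega0 ^ ζ) t') w

open Classical in
/-- `ℙ_ξ(s) = p_ξ(s, t)` for any maximal extension `t` of `s` in `Γ_ξ`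
(and `0` if `s ∉ Γ_ξ`, a value that is never used). -/
noncomputable def prob (ξ : Ordinal.{u}) (s : List Ordinal.{u}) : ℝ :=
  if h : ∃ w t, HasWeight ξ s t w then h.choose else 0

section WellDefined

/-! `ℙ_ξ` is well defined on `Γ_ξ`. -/

open Ordinal

theorem lt_mul_of {ξ : Ordinal.{u}} {x : Ordinal.{u}} (hx : x < omega0 ^ ξ) (n : ℕ) :
    omega0 ^ ξ * n + x < omega0 ^ ξ * (n + 1 : ℕ) := by
  push_cast
  rw [mul_add_one]
  gcongr

theorem gammaLevel_lt {ξ : Ordinal.{u}} {G : Set (List Ordinal.{u})}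
    (hG : ∀ t ∈ G, ∀ x ∈ t, x < omega0 ^ ξ) (n : ℕ) :
    ∀ t ∈ gammaLevel ξ G n, ∀ x ∈ t, x < omega0 ^ ξ * n := by
  have mono : ∀ n : ℕ, omega0 ^ ξ * n ≤ omega0 ^ ξ * (n + 1 : ℕ) := by
    intro n; gcongr; simp
  induction n with
  | zero => simp [gammaLevel]
  | succ n ih =>
    have key : ∀ t ∈ G, ∀ x ∈ shift (omega0 ^ ξ * n) t, x < omega0 ^ ξ * (n + 1 : ℕ) := by
      intro t ht x hx
      obtain ⟨y, hy, rfl⟩ := List.mem_map.1 hx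
      exact lt_mul_of (hG t ht y hy) n
    rintro r (⟨t, ht, rfl⟩ | ⟨t, ht, v, hv, rfl⟩) x hx
    · exact key t ht x hx
    · rcases List.mem_append.1 hx with hx | hx
      · exact key t ht.1 x hx
      · exact (ih v hv x hx).trans_le (mono n)

theorem Gam_lt (ξ : Ordinal.{u}) : ∀ t ∈ Gam ξ, ∀ x ∈ t, x < omega0 ^ ξ := by
  induction ξ using Ordinal.limitRecOn with
  | zero => rw [Gam_zero]; simp
  | add_one ξ ih =>
    rw [Gam_add_one]
    intro t ht x hx
    obtain ⟨n, hn⟩ := Set.mem_iUnion.1 ht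
    refine (gammaLevel_lt ih n t hn x hx).trans ?_
    rw [opow_add, opow_one]
    have := opow_pos ξ omega0_pos
    gcongr
    exact natCast_lt_omega0 n
  | limit ξ hξ ih =>
    rw [Gam_limit hξ]
    simp only [Set.mem_iUnion]
    rintro _ ⟨ζ, hζ, t, ht, rfl⟩ x hx
    obtain ⟨y, hy, rfl⟩ := List.mem_map.1 hx
    have h1 := ih _ (hξ.add_one_lt hζ) t ht y hy
    have hlt : omega0 ^ (ζ + 1) < omega0 ^ ξ :=
      (opow_lt_opow_iff_right one_lt_omega0).2 (hξ.add_one_lt hζ)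
    refine lt_trans ?_ hlt
    refine isPrincipal_add_omega0_opow (ζ + 1) ?_ h1
    exact (opow_lt_opow_iff_right one_lt_omega0).2 (by simp)

theorem log_opow_add (ζ y : Ordinal.{u}) (hy : y < omega0 ^ (ζ + 1)) :
    Ordinal.log omega0 (omega0 ^ ζ + y) = ζ := by
  have hp := opow_pos ζ omega0_pos
  have h1 : omega0 ^ ζ ≤ omega0 ^ ζ + y := by simp
  have h2 : omega0 ^ ζ + y < omega0 ^ (ζ + 1) :=
    isPrincipal_add_omega0_opow (ζ + 1)
      ((opow_lt_opow_iff_right one_lt_omega0).2 (by simp)) hy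
  have h0 : omega0 ^ ζ + y ≠ 0 := (hp.trans_le h1).ne'
  apply le_antisymm
  · exact Order.lt_succ_iff.1 (by
      rw [Order.succ_eq_add_one]
      exact (lt_opow_iff_log_lt one_lt_omega0 h0).1 h2)
  · exact (opow_le_iff_le_log one_lt_omega0 h0).1 h1

theorem levelConcat_lt {ξ : Ordinal.{u}} (l : List (List Ordinal.{u})) (n : ℕ)
    (hl : ∀ t ∈ l, ∀ x ∈ t, x < omega0 ^ ξ) :
    ∀ x ∈ levelConcat ξ n l, x < omega0 ^ ξ * n := by
  have mono : ∀ n : ℕ, omega0 ^ ξ * n ≤ omega0 ^ ξ * (n + 1 : ℕ) := by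
    intro n; gcongr; simp
  induction l generalizing n with
  | nil => simp [levelConcat]
  | cons t l ih =>
    rcases n with _ | n
    · simp [levelConcat]
    · intro x hx
      rcases List.mem_append.1 hx with hx | hx
      · obtain ⟨y, hy, rfl⟩ := List.mem_map.1 hx
        exact lt_mul_of (hl t (by simp) y hy) n
      · exact (ih n (fun t ht => hl t (by simp [ht])) x hx).trans_le (mono n)

theorem shift_inj {a : Ordinal.{u}} {s t : List Ordinal.{u}} (h : shift a s = shift a t) : s = t :=
  List.map_injective_iff.2 (fun x y hxy => by simpa using hxy) h

theorem shift_append_inj {ξ : Ordinal.{u}} {n : ℕ} {s t v w : List Ordinal.{u}}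
    (hv : ∀ x ∈ v, x < omega0 ^ ξ * n) (hw : ∀ x ∈ w, x < omega0 ^ ξ * n)
    (h : shift (omega0 ^ ξ * n) s ++ v = shift (omega0 ^ ξ * n) t ++ w) : s = t ∧ v = w := by
  have e1 : ∀ (s v : List Ordinal.{u}), (∀ x ∈ v, x < omega0 ^ ξ * n) →
      (shift (omega0 ^ ξ * n) s ++ v).filter (fun x => decide (omega0 ^ ξ * n ≤ x))
        = shift (omega0 ^ ξ * n) s := by
    intro s v hv
    rw [List.filter_append, List.filter_eq_self.2, List.filter_eq_nil_iff.2, List.append_nil]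
    · intro x hx; simpa using hv x hx
    · intro x hx
      obtain ⟨y, hy, rfl⟩ := List.mem_map.1 hx
      simp
  have h1 : shift (omega0 ^ ξ * n) s = shift (omega0 ^ ξ * n) t := by
    rw [← e1 s v hv, h, e1 t w hw]
  exact ⟨shift_inj h1, by rw [h1] at h; exact List.append_cancel_left h⟩

theorem levelConcat_ne_nil {ξ : Ordinal.{u}} {n : ℕ} {t : List Ordinal.{u}}
    {l : List (List Ordinal.{u})} (ht : t ≠ []) : levelConcat ξ (n + 1) (t :: l) ≠ [] := by
  simp [levelConcat, shift, ht]

theorem levelConcat_n {ξ : Ordinal.{u}} {n m : ℕ} {t t' : List Ordinal.{u}}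
    {l l' : List (List Ordinal.{u})} (ht : t ≠ []) (ht' : t' ≠ [])
    (hl : ∀ x ∈ t, x < omega0 ^ ξ) (hl' : ∀ x ∈ t', x < omega0 ^ ξ)
    (h : levelConcat ξ (n + 1) (t :: l) = levelConcat ξ (m + 1) (t' :: l')) : n = m := by
  obtain ⟨a, t, rfl⟩ := List.exists_cons_of_ne_nil ht
  obtain ⟨b, t', rfl⟩ := List.exists_cons_of_ne_nil ht'
  simp only [levelConcat, shift, List.map_cons, List.cons_append, List.cons.injEq] at h
  have h1 := congrArg (· / omega0 ^ ξ) h.1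
  have := (opow_pos ξ omega0_pos).ne'
  simp only [mul_add_div _ this, div_eq_zero_of_lt (hl a (by simp)),
    div_eq_zero_of_lt (hl' b (by simp)), add_zero] at h1
  exact_mod_cast h1

theorem levelConcat_last {ξ : Ordinal.{u}} (l : List (List Ordinal.{u})) :
    ∀ (l' : List (List Ordinal.{u})) (n : ℕ) (s s' : List Ordinal.{u}),
    (∀ t ∈ l, t ≠ [] ∧ ∀ x ∈ t, x < omega0 ^ ξ) → (∀ t ∈ l', t ≠ [] ∧ ∀ x ∈ t, x < omega0 ^ ξ) →
    s ≠ [] → s' ≠ [] → (∀ x ∈ s, x < omega0 ^ ξ) → (∀ x ∈ s', x < omega0 ^ ξ) →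
    l.length < n → l'.length < n →
    levelConcat ξ n (l ++ [s]) = levelConcat ξ n (l' ++ [s']) → s = s' := by
  induction l with
  | nil =>
    intro l' n s s' hl hl' hs hs' hb hb' hn hn' h
    obtain ⟨n, rfl⟩ := Nat.exists_eq_succ_of_ne_zero (by omega : n ≠ 0)
    rcases l' with _ | ⟨t, l'⟩
    · exact (shift_append_inj (by simp [levelConcat]) (by simp [levelConcat]) h).1
    · exfalso
      have hb2 : ∀ x ∈ levelConcat ξ n (l' ++ [s']), x < omega0 ^ ξ * n := by
        apply levelConcat_lt
        intro t ht
        rcases List.mem_append.1 ht with ht | ht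
        · exact (hl' t (by simp [ht])).2
        · simp only [List.mem_singleton] at ht; subst ht; exact hb'
      have h2 := (shift_append_inj (by simp [levelConcat]) hb2 h).2
      obtain ⟨n, rfl⟩ := Nat.exists_eq_succ_of_ne_zero (by simp at hn'; omega : n ≠ 0)
      rcases l' with _ | ⟨a, l'⟩
      · exact levelConcat_ne_nil hs' h2.symm
      · exact levelConcat_ne_nil (hl' a (by simp)).1 h2.symm
  | cons t l ih =>
    intro l' n s s' hl hl' hs hs' hb hb' hn hn' h
    obtain ⟨n, rfl⟩ := Nat.exists_eq_succ_of_ne_zero (by omega : n ≠ 0)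
    have B : ∀ (l : List (List Ordinal.{u})) s, (∀ t ∈ l, t ≠ [] ∧ ∀ x ∈ t, x < omega0 ^ ξ) →
        (∀ x ∈ s, x < omega0 ^ ξ) → ∀ x ∈ levelConcat ξ n (l ++ [s]), x < omega0 ^ ξ * n := by
      intro l s hl hs
      apply levelConcat_lt
      intro t ht
      rcases List.mem_append.1 ht with ht | ht
      · exact (hl t ht).2
      · simp only [List.mem_singleton] at ht; subst ht; exact hs
    have hl2 : ∀ t ∈ l, t ≠ [] ∧ ∀ x ∈ t, x < omega0 ^ ξ := fun t ht => hl t (by simp [ht])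
    rcases l' with _ | ⟨t', l'⟩
    · exfalso
      have h2 := (shift_append_inj (B l s hl2 hb) (by simp [levelConcat]) h).2
      obtain ⟨n, rfl⟩ := Nat.exists_eq_succ_of_ne_zero (by simp at hn; omega : n ≠ 0)
      rcases l with _ | ⟨a, l⟩
      · exact levelConcat_ne_nil hs h2
      · exact levelConcat_ne_nil (hl a (by simp)).1 h2
    · have hl2' : ∀ t ∈ l', t ≠ [] ∧ ∀ x ∈ t, x < omega0 ^ ξ := fun t ht => hl' t (by simp [ht])
      have h2 := (shift_append_inj (B l s hl2 hb) (B l' s' hl2' hb') h).2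
      exact ih l' n s s' hl2 hl2' hs hs' hb hb' (by simpa using hn) (by simpa using hn') h2

theorem HasWeight.isInit {ξ : Ordinal.{u}} {s t : List Ordinal.{u}} {w : ℝ}
    (h : HasWeight ξ s t w) : s ≠ [] ∧ s <+: t ∧ t ∈ Gam ξ := by
  have cat : ∀ (ξ : Ordinal.{u}) (l : List (List Ordinal.{u})) (n : ℕ) (s t r), s ≠ [] → s <+: t →
      l.length < n → levelConcat ξ n (l ++ [s]) ≠ [] ∧
      levelConcat ξ n (l ++ [s]) <+: levelConcat ξ n (l ++ t :: r) := by
    intro ξ l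
    induction l with
    | nil =>
      intro n s t r hs hst hn
      obtain ⟨n, rfl⟩ := Nat.exists_eq_succ_of_ne_zero (by omega : n ≠ 0)
      refine ⟨levelConcat_ne_nil hs, ?_⟩
      simp only [levelConcat, List.nil_append, List.append_nil]
      exact (hst.map _).trans (List.prefix_append _ _)
    | cons a l ih =>
      intro n s t r hs hst hn
      obtain ⟨n, rfl⟩ := Nat.exists_eq_succ_of_ne_zero (by omega : n ≠ 0)
      have := ih n s t r hs hst (by simpa using hn)
      simp only [levelConcat, List.cons_append]
      exact ⟨by simp [this.1], (List.prefix_append_right_inj _).2 this.2⟩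
  have mem : ∀ (ξ : Ordinal.{u}) (l : List (List Ordinal.{u})), l ≠ [] →
      (∀ x ∈ l, x ∈ maxElts (Gam ξ)) → levelConcat ξ l.length l ∈ gammaLevel ξ (Gam ξ) l.length := by
    intro ξ l
    induction l with
    | nil => simp
    | cons a l ih =>
      intro _ hl
      rcases eq_or_ne l [] with rfl | hne
      · refine Or.inl ⟨a, (hl a (by simp)).1, by simp [levelConcat]⟩
      · exact Or.inr ⟨a, hl a (by simp), _, ih hne (fun x hx => hl x (by simp [hx])), rfl⟩
  induction h with
  | zero => simp [Gam_zero]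
  | add_one ξ l t' r n s' w hn hmax hw ih =>
    obtain ⟨h1, h2⟩ := cat ξ l n s' t' r ih.1 ih.2.1 (by simp [hn])
    refine ⟨h1, h2, ?_⟩
    rw [Gam_add_one]
    subst hn
    exact Set.mem_iUnion.2 ⟨_, mem ξ _ (by simp) hmax⟩
  | limit ξ ζ s' t' w hξ hζ hw ih =>
    refine ⟨by simpa [shift] using ih.1, ih.2.1.map _, ?_⟩
    rw [Gam_limit hξ]
    simp only [Set.mem_iUnion]
    exact ⟨ζ, hζ, t', ih.2.2, rfl⟩

theorem HasWeight.mem {ξ : Ordinal.{u}} {s t : List Ordinal.{u}} {w : ℝ}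
    (h : HasWeight ξ s t w) : s ∈ Gam ξ :=
  (isBTree_Gam ξ).2 t h.isInit.2.2 s h.isInit.1 h.isInit.2.1

/-- `p_ξ(s, t)` is single valued and does not depend on `t`. -/
theorem HasWeight.unique {ξ : Ordinal.{u}} {s t t' : List Ordinal.{u}} {w w' : ℝ}
    (h : HasWeight ξ s t w) (h' : HasWeight ξ s t' w') : w = w' := by
  induction h generalizing t' w' with
  | zero =>
    generalize hs : ([0] : List Ordinal.{u}) = s at h'
    generalize hξ : (0 : Ordinal.{u}) = η at h'
    cases h' with
    | zero => rfl
    | add_one ξ' => exact absurd hξ.symm (Order.succ_ne_bot ξ')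
    | limit _ _ _ _ _ h => exact absurd hξ.symm h.ne_bot
  | add_one ξ l t₁ r n s₁ w hn hmax hw ih =>
    generalize hξ : ξ + 1 = η at h'
    generalize hs : levelConcat ξ n (l ++ [s₁]) = s at h'
    cases h' with
    | zero => simp at hξ
    | add_one ξ' l' t₁' r' n' s₁' w' hn' hmax' hw' =>
      obtain rfl : ξ = ξ' := by simpa using hξ
      have G : ∀ t ∈ Gam ξ, t ≠ [] ∧ ∀ x ∈ t, x < omega0 ^ ξ := fun t ht =>
        ⟨fun h => (isBTree_Gam ξ).1 (h ▸ ht), Gam_lt ξ t ht⟩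
      have hl : ∀ t ∈ l, t ≠ [] ∧ ∀ x ∈ t, x < omega0 ^ ξ := fun t ht =>
        G t (hmax t (by simp [ht])).1
      have hl' : ∀ t ∈ l', t ≠ [] ∧ ∀ x ∈ t, x < omega0 ^ ξ := fun t ht =>
        G t (hmax' t (by simp [ht])).1
      have gs := G _ hw.mem
      have gs' := G _ hw'.mem
      have hnn : n = n' := by
        obtain ⟨k, rfl⟩ := Nat.exists_eq_succ_of_ne_zero (by simp [hn] : n ≠ 0)
        obtain ⟨k', rfl⟩ := Nat.exists_eq_succ_of_ne_zero (by simp [hn'] : n' ≠ 0)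
        obtain ⟨a, m, ham, ha⟩ : ∃ a m, l ++ [s₁] = a :: m ∧ (a ≠ [] ∧ ∀ x ∈ a, x < omega0 ^ ξ) := by
          rcases l with _ | ⟨a, m⟩
          · exact ⟨_, _, rfl, gs⟩
          · exact ⟨_, _, rfl, hl a (by simp)⟩
        obtain ⟨a', m', ham', ha'⟩ :
            ∃ a m, l' ++ [s₁'] = a :: m ∧ (a ≠ [] ∧ ∀ x ∈ a, x < omega0 ^ ξ) := by
          rcases l' with _ | ⟨a, m⟩
          · exact ⟨_, _, rfl, gs'⟩
          · exact ⟨_, _, rfl, hl' a (by simp)⟩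
        rw [ham, ham'] at hs
        rw [levelConcat_n ha.1 ha'.1 ha.2 ha'.2 hs]
      subst hnn
      obtain rfl := levelConcat_last l l' n s₁ s₁' hl hl' gs.1 gs'.1 gs.2 gs'.2
        (by simp [hn]) (by simp [hn']) hs
      rw [ih hw']
    | limit _ _ _ _ _ h =>
      subst hξ
      have := h.add_one_lt (by simp : ξ < ξ + 1)
      simp at this
  | limit ξ ζ s₁ t₁ w hξ hζ hw ih =>
    generalize hs : shift (omega0 ^ ζ) s₁ = s at h'
    cases h' with
    | zero => exact absurd rfl hξ.ne_bot
    | add_one ξ' =>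
      have := hξ.add_one_lt (by simp : ξ' < ξ' + 1)
      simp at this
    | limit _ ζ' s₁' t₁' w' hξ' hζ' hw' =>
      obtain ⟨a, m, rfl⟩ := List.exists_cons_of_ne_nil hw.isInit.1
      obtain ⟨a', m', rfl⟩ := List.exists_cons_of_ne_nil hw'.isInit.1
      have e : omega0 ^ ζ + a = omega0 ^ ζ' + a' := by
        simp only [shift, List.map_cons, List.cons.injEq] at hs
        exact hs.1
      have hz : ζ = ζ' := by
        rw [← log_opow_add ζ a (Gam_lt _ _ hw.mem a (by simp)), e,
          log_opow_add ζ' a' (Gam_lt _ _ hw'.mem a' (by simp))]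
      subst hz
      rw [← shift_inj hs] at hw'
      exact ih hw'

theorem HasWeight.prob_eq {ξ : Ordinal.{u}} {s t : List Ordinal.{u}} {w : ℝ}
    (h : HasWeight ξ s t w) : prob ξ s = w := by
  have hex : ∃ w t, HasWeight ξ s t w := ⟨w, t, h⟩
  rw [prob, dif_pos hex]
  exact hex.choose_spec.choose_spec.unique h

/-- Every `s ∈ Γ_ξ` has a maximal extension `t`, and `p_ξ(s, t)` is defined. -/
theorem exists_weight (ξ : Ordinal.{u}) : (Gam ξ).Nonempty ∧ ∀ s ∈ Gam ξ,
    ∃ t ∈ maxElts (Gam ξ), ∃ w, HasWeight ξ s t w := by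
  have G0 : ∀ (ξ : Ordinal.{u}), ∀ t ∈ Gam ξ, t ≠ [] ∧ ∀ x ∈ t, x < omega0 ^ ξ := fun ξ t ht =>
        ⟨fun h => (isBTree_Gam ξ).1 (h ▸ ht), Gam_lt ξ t ht⟩
  induction ξ using Ordinal.limitRecOn with
  | zero => 
    rw [Gam_zero]
    refine ⟨by simp, ?_⟩
    rintro s rfl
    exact ⟨[0], ⟨rfl, by rintro s rfl _; rfl⟩, 1, .zero⟩
  | add_one ξ ih =>
    obtain ⟨⟨s0, hs0⟩, ih⟩ := ih
    obtain ⟨m0, hm0, _⟩ := ih s0 hs0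
    refine ⟨⟨s0, by rw [Gam_add_one]; exact Set.mem_iUnion.2 ⟨1, by rwa [gammaLevel_one]⟩⟩, ?_⟩
    have dec : ∀ n, ∀ s ∈ gammaLevel ξ (Gam ξ) n, ∃ l s', (∀ x ∈ l, x ∈ maxElts (Gam ξ)) ∧
        s' ∈ Gam ξ ∧ l.length < n ∧ s = levelConcat ξ n (l ++ [s']) := by
      intro n
      induction n with
      | zero => simp [gammaLevel]
      | succ n ihn =>
        rintro s (⟨t, ht, rfl⟩ | ⟨t, ht, v, hv, rfl⟩)
        · exact ⟨[], t, by simp, ht, by simp, by simp [levelConcat]⟩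
        · obtain ⟨l, s', h1, h2, h3, rfl⟩ := ihn v hv
          exact ⟨t :: l, s', by simpa using ⟨ht, h1⟩, h2, by simpa using h3, rfl⟩
    -- full concatenations are maximal
    have mx : ∀ (l : List (List Ordinal.{u})), l ≠ [] → (∀ x ∈ l, x ∈ maxElts (Gam ξ)) →
        ∀ s ∈ gammaLevel ξ (Gam ξ) l.length, levelConcat ξ l.length l <+: s →
          s = levelConcat ξ l.length l := by
      intro l
      induction l with
      | nil => simp
      | cons a l ihl =>
        intro _ hl s hs hst
        have split : ∀ (b v : List Ordinal.{u}), b ∈ Gam ξ → (∀ x ∈ v, x < omega0 ^ ξ * l.length) →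
          levelConcat ξ (l.length + 1) (a :: l) <+: shift (omega0 ^ ξ * l.length) b ++ v →
            a = b ∧ levelConcat ξ l.length l <+: v := by
          intro b v hb hv h
          simp only [levelConcat] at h
          have lc : ∀ x ∈ levelConcat ξ l.length l, x < omega0 ^ ξ * l.length :=
            levelConcat_lt _ _ (fun t ht => Gam_lt ξ t (hl t (by simp [ht])).1)
          have hab : a <+: b := by
            have := h.filter (fun x => decide (omega0 ^ ξ * l.length ≤ x))
            rw [List.filter_append, List.filter_append, List.filter_eq_self.2,
              (List.filter_eq_nil_iff (l := levelConcat _ _ _)).2, List.filter_eq_self.2,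
              (List.filter_eq_nil_iff (l := v)).2] at this
            · simp only [List.append_nil] at this
              obtain ⟨r, hr, h⟩ := List.prefix_map_iff.1 this
              rw [shift_inj h]; exact hr
            · intro x hx; simpa using hv x hx
            · intro x hx
              obtain ⟨y, hy, rfl⟩ := List.mem_map.1 hx
              simp
            · intro x hx; simpa using lc x hx
            · intro x hx
              obtain ⟨y, hy, rfl⟩ := List.mem_map.1 hx
              simp
          have := (hl a (by simp)).2 b hb hab
          subst this
          exact ⟨rfl, (List.prefix_append_right_inj _).1 h⟩
        rcases hs with ⟨t, ht, rfl⟩ | ⟨t, ht, v, hv, rfl⟩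
        · obtain ⟨rfl, h⟩ := split t [] ht (by simp) (by simpa using hst)
          rw [List.prefix_nil] at h
          simp [levelConcat, h]
        · obtain ⟨rfl, h⟩ := split t v ht.1 (gammaLevel_lt (Gam_lt ξ) _ v hv) hst
          rcases eq_or_ne l [] with rfl | hne
          · simp [gammaLevel] at hv
          · rw [ihl hne (fun x hx => hl x (by simp [hx])) v hv h]; rfl
    rw [Gam_add_one]
    intro s hs
    obtain ⟨n, hn⟩ := Set.mem_iUnion.1 hs
    obtain ⟨l, s', h1, h2, h3, rfl⟩ := dec n s hn
    obtain ⟨t', ht', w, hw⟩ := ih s' h2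
    let L := l ++ t' :: List.replicate (n - l.length - 1) m0
    have hL : L.length = n := by simp [L]; omega
    have hLm : ∀ x ∈ L, x ∈ maxElts (Gam ξ) := by
      intro x hx
      simp only [L, List.mem_append, List.mem_cons, List.mem_replicate] at hx
      rcases hx with hx | rfl | ⟨_, rfl⟩
      · exact h1 x hx
      · exact ht'
      · exact hm0
    have W := HasWeight.add_one ξ l t' (List.replicate (n - l.length - 1) m0) n s' w hL.symm hLm hw
    refine ⟨_, ⟨by rw [← Gam_add_one]; exact W.isInit.2.2, ?_⟩, _, W⟩
    intro s2 hs2 hpre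
    obtain ⟨k, hk⟩ := Set.mem_iUnion.1 hs2
    have hkn : k = n := by
      obtain ⟨l2, s2', h1', h2', h3', rfl⟩ := dec k s2 hk
      obtain ⟨k, rfl⟩ := Nat.exists_eq_succ_of_ne_zero (by omega : k ≠ 0)
      obtain ⟨n, rfl⟩ := Nat.exists_eq_succ_of_ne_zero (by omega : n ≠ 0)
      obtain ⟨a, m, ham, ha⟩ : ∃ a m, L = a :: m ∧ a ∈ Gam ξ := by
        rcases hh : L with _ | ⟨a, m⟩
        · simp [hh] at hL
        · exact ⟨_, _, rfl, (hLm a (by simp [hh])).1⟩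
      obtain ⟨b, m', hbm, hb⟩ : ∃ a m, l2 ++ [s2'] = a :: m ∧ a ∈ Gam ξ := by
        rcases l2 with _ | ⟨a, m⟩
        · exact ⟨_, _, rfl, h2'⟩
        · exact ⟨_, _, rfl, (h1' a (by simp)).1⟩
      change levelConcat ξ (n+1) L <+: _ at hpre
      rw [ham, hbm] at hpre
      have ga := G0 ξ a ha
      have gb := G0 ξ b hb
      obtain ⟨x, a, rfl⟩ := List.exists_cons_of_ne_nil ga.1
      obtain ⟨y, b, rfl⟩ := List.exists_cons_of_ne_nil gb.1
      simp only [levelConcat, shift, List.map_cons, List.cons_append, List.cons_prefix_cons] at hpre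
      have e := congrArg (· / omega0 ^ ξ) hpre.1
      have := (opow_pos ξ omega0_pos).ne'
      simp only [mul_add_div _ this, div_eq_zero_of_lt (ga.2 x (by simp)),
        div_eq_zero_of_lt (gb.2 y (by simp)), add_zero] at e
      have : n = k := by exact_mod_cast e
      simp [this]
    subst hkn
    have := mx L (by simp [L]) hLm s2 (hL ▸ hk) (by rw [hL]; exact hpre)
    rw [this, hL]
  | limit ξ hξ ih =>
    obtain ⟨⟨s0, hs0⟩, _⟩ := ih _ (hξ.add_one_lt hξ.bot_lt)
    refine ⟨⟨shift (omega0 ^ (0:Ordinal)) s0, by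
      rw [Gam_limit hξ]; simp only [Set.mem_iUnion]
      exact ⟨0, hξ.bot_lt, s0, hs0, rfl⟩⟩, ?_⟩
    intro s hs
    rw [Gam_limit hξ] at hs
    simp only [Set.mem_iUnion] at hs
    obtain ⟨ζ, hζ, s', hs', rfl⟩ := hs
    obtain ⟨t, ht, w, hw⟩ := (ih _ (hξ.add_one_lt hζ)).2 s' hs'
    have W := HasWeight.limit ξ ζ s' t w hξ hζ hw
    refine ⟨_, ⟨W.isInit.2.2, ?_⟩, w, W⟩
    intro s2 hs2 hp
    rw [Gam_limit hξ] at hs2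
    simp only [Set.mem_iUnion] at hs2
    obtain ⟨η, hη, s2, hs2, rfl⟩ := hs2
    have gt := G0 _ t ht.1
    have gs := G0 _ s2 hs2
    obtain ⟨a, m, rfl⟩ := List.exists_cons_of_ne_nil gt.1
    obtain ⟨b, m', rfl⟩ := List.exists_cons_of_ne_nil gs.1
    have e : ζ = η := by
      simp only [shift, List.map_cons, List.cons_prefix_cons] at hp
      rw [← log_opow_add ζ a (gt.2 a (by simp)), hp.1, log_opow_add η b (gs.2 b (by simp))]
    subst e
    obtain ⟨r, hr, h⟩ := List.prefix_map_iff.1 hp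
    rw [← shift_inj h] at hr
    rw [ht.2 _ hs2 hr]

end WellDefined

/-- `T D = {(t, σ) : t ∈ T, σ a sequence in D with |σ| = |t|}`, as sequences of pairs. -/
def treeProd {Λ : Type*} (T : Set (List Λ)) (D : Type*) : Set (List (Λ × D)) :=
  {τ | τ.map Prod.fst ∈ T}

/-- `Ω_ξ = Γ_ξ D`. -/
def Omg (ξ : Ordinal.{u}) (D : Type v) : Set (List (Ordinal.{u} × D)) :=
  treeProd (Gam ξ) D

theorem isBTree_Omg (ξ : Ordinal.{u}) (D : Type v) : IsBTree (Omg ξ D) := by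
  refine ⟨fun h => (isBTree_Gam ξ).1 h, fun t ht s hs hst => ?_⟩
  exact (isBTree_Gam ξ).2 _ ht _ (by simpa using hs) (hst.map _)

/-- An extended pruning `(θ, e) : S₁ → S₂` between subsets of trees `T₁ D`, `T₂ D`: a map `θ` that
is monotone for proper initial segments and does not decrease the last `D`-coordinate,
with a map `e` of the maximal members such that `θ(τ) ⪯ e(τ)`. -/
structure ExtPruning {Λ₁ Λ₂ : Type*} {D : Type*} [Preorder D]
    (S₁ : Set (List (Λ₁ × D))) (S₂ : Set (List (Λ₂ × D))) where
  θ : S₁ → S₂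
  e : maxElts S₁ → maxElts S₂
  monotone : ∀ τ τ' : S₁, τ.1 <+: τ'.1 → τ.1 ≠ τ'.1 →
    (θ τ).1 <+: (θ τ').1 ∧ (θ τ).1 ≠ (θ τ').1
  le_last : ∀ τ : S₁, ∀ x ∈ τ.1.getLast?, ∀ y ∈ (θ τ).1.getLast?, x.2 ≤ y.2
  prefix_e : ∀ τ : maxElts S₁, (θ ⟨τ.1, τ.2.1⟩).1 <+: (e τ).1

/-- The pair `(θ(τ'), e(τ)) ∈ Π S₂` for `(τ', τ) ∈ Π S₁`. -/
def ExtPruning.mapPair {Λ₁ Λ₂ : Type*} {D : Type*} [Preorder D]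
    {S₁ : Set (List (Λ₁ × D))} {S₂ : Set (List (Λ₂ × D))} (P : ExtPruning S₁ S₂)
    (q : branchPairs S₁) : branchPairs S₂ :=
  ⟨((P.θ ⟨q.1.1, q.2.1⟩).1, (P.e ⟨q.1.2, q.2.2.1⟩).1), (P.θ _).2, (P.e _).2, by
    refine List.IsPrefix.trans ?_ (P.prefix_e ⟨q.1.2, q.2.2.1⟩)
    by_cases h : q.1.1 = q.1.2
    · simp only [h]; exact List.prefix_rfl
    · exact (P.monotone ⟨q.1.1, q.2.1⟩ ⟨q.1.2, q.2.2.1.1⟩ q.2.2.2 h).1⟩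

/-- The pair `(τ|_{i+1}, τ) ∈ Π Ω_ξ` for `τ ∈ MAX(Ω_ξ)` and `i < |τ|`. -/
def initPair {ξ : Ordinal.{u}} {D : Type v} (τ : maxElts (Omg ξ D)) (i : Fin τ.1.length) :
    branchPairs (Omg ξ D) :=
  ⟨(τ.1.take (i + 1), τ.1),
    (isBTree_Omg ξ D).2 τ.1 τ.2.1 _
      (by
        have := i.2
        intro h
        rcases List.take_eq_nil_iff.1 h with h | h
        · simp at h
        · simp [h] at this)
      (List.take_prefix _ _),
    τ.2, List.take_prefix _ _⟩

/-- The weighted branch average `∑_{∅ ≺ τ' ⪯ τ} ℙ_ξ(τ') g(τ', τ)`, where `ℙ_ξ(t, σ) = ℙ_ξ(t)`;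
the nonempty initial segments of `τ` are its restrictions to the lengths `1, …, |τ|`. -/
noncomputable def branchAvg {ξ : Ordinal.{u}} {D : Type v} (g : branchPairs (Omg ξ D) → ℝ)
    (τ : maxElts (Omg ξ D)) : ℝ :=
  ∑ i : Fin τ.1.length, prob ξ ((τ.1.take (i + 1)).map Prod.fst) * g (initPair τ i)

/-- `g` is `ε`-small. -/
def IsSmall {ξ : Ordinal.{u}} {D : Type v} [Preorder D] (g : branchPairs (Omg ξ D) → ℝ)
    (ε : ℝ) : Prop :=
  ∃ P : ExtPruning (Omg ξ D) (Omg ξ D), ∀ τ : maxElts (Omg ξ D), branchAvg g (P.e τ) < ε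

/-- `g` is `ε`-large. -/
def IsLarge {ξ : Ordinal.{u}} {D : Type v} [Preorder D] (g : branchPairs (Omg ξ D) → ℝ)
    (ε : ℝ) : Prop :=
  ∀ δ : ℝ, 0 < δ → ∃ P : ExtPruning (Omg ξ D) (Omg ξ D),
    ∀ q : branchPairs (Omg ξ D), ε - δ ≤ g (P.mapPair q)

end OrdTree

/-!
The proof is by transfinite induction on `ξ`. For a limit `ξ`, `Ω_ξ` is the union of shifted copies
of the `Ω_{ζ+1}`, and `Ω_{ξ+1}` is the union of the `Ω_{ξ,n}`, with members of different components
incomparable. As earlier components embed into later ones, it suffices to handle cofinally many of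
them, and at a limit one of the two alternatives holds cofinally.

For the successor step, `Ω_{ξ,n+1}` is a copy of `Ω_ξ`, the first stage, each maximal member of
which is continued by a copy of `Ω_{ξ,n}`. Below a fixed branch `b` of the first stage, the values
of the function at the initial segments of `b` depend on how the branch continues, but pruning
`Ω_{ξ,n}` according to a finite colouring makes this dependence negligible, so that the case `ξ`
applies to the first stage. Iterating, one obtains prunings along which `j` of the `n` stages are
large, in that all values are almost at least `ε`, and the averages over the others are almost
below `ε`. If `j` is unbounded as `n` grows, the large stages give largeness on `Ω_{ξ+1}`; if not,
the large stages contribute at most a bounded multiple of `1 / n` to the averages.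
-/

namespace OrdTree

section Components

variable {ι α : Type*}

/-- `S` is the union of the sets `A i`, and members of different `A i` are incomparable. -/
structure IsComponents (A : ι → Set (List α)) (S : Set (List α)) : Prop where
  subset : ∀ i, A i ⊆ S
  cover : ∀ τ ∈ S, ∃ i, τ ∈ A i
  sep : ∀ i j, ∀ τ ∈ A i, ∀ τ' ∈ A j, τ <+: τ' → i = j

namespace IsComponents

variable {A : ι → Set (List α)} {S : Set (List α)} {τ τ' : List α} {i : ι}

theorem mem_upward (h : IsComponents A S) (hτ : τ ∈ A i) (hτ' : τ' ∈ S) (hp : τ <+: τ') :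
    τ' ∈ A i := by
  obtain ⟨j, hj⟩ := h.cover τ' hτ'
  exact h.sep i j τ hτ τ' hj hp ▸ hj

theorem mem_downward (h : IsComponents A S) (hτ : τ ∈ S) (hτ' : τ' ∈ A i) (hp : τ <+: τ') :
    τ ∈ A i := by
  obtain ⟨j, hj⟩ := h.cover τ hτ
  exact h.sep j i τ hj τ' hτ' hp ▸ hj

theorem mem_maxElts (h : IsComponents A S) (hi : τ ∈ A i) (hτ : τ ∈ maxElts S) :
    τ ∈ maxElts (A i) :=
  ⟨hi, fun s hs hp => hτ.2 s (h.subset i hs) hp⟩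

open Classical in
/-- The map equal to `f i` on `A i`, and to `[]` off the components. -/
noncomputable def glue {β : Type*} (A : ι → Set (List α))
    (f : ι → List α → List β) (τ : List α) : List β :=
  if h : ∃ i, τ ∈ A i then f h.choose τ else []

theorem glue_eq {β : Type*} (h : IsComponents A S) (f : ι → List α → List β)
    (hi : τ ∈ A i) : glue A f τ = f i τ := by
  have hex : ∃ j, τ ∈ A j := ⟨i, hi⟩
  rw [glue, dif_pos hex, h.sep _ _ τ hex.choose_spec τ hi List.prefix_rfl]

end IsComponents

end Components

section Prunings

variable {Λ₁ Λ₂ Λ₃ D : Type*} [Preorder D] {S₁ : Set (List (Λ₁ × D))} {S₂ T : Set (List (Λ₂ × D))}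
  {S₃ : Set (List (Λ₃ × D))}

/-- Extended prunings between sets of sequences, as in `ExtPruning`, but encoded by total maps whose
values outside `S₁` (for `e`, outside `maxElts S₁`) are irrelevant, and with sequences over
possibly different index sets. -/
structure PruneMap (S₁ : Set (List (Λ₁ × D))) (S₂ : Set (List (Λ₂ × D))) where
  θ : List (Λ₁ × D) → List (Λ₂ × D)
  e : List (Λ₁ × D) → List (Λ₂ × D)
  map_mem : ∀ τ ∈ S₁, θ τ ∈ S₂
  map_max : ∀ τ ∈ maxElts S₁, e τ ∈ maxElts S₂
  mono : ∀ τ ∈ S₁, ∀ τ' ∈ S₁, τ <+: τ' → τ ≠ τ' → θ τ <+: θ τ' ∧ θ τ ≠ θ τ'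
  le_last : ∀ τ ∈ S₁, ∀ x ∈ τ.getLast?, ∃ y ∈ (θ τ).getLast?, x.2 ≤ y.2
  prefix_e : ∀ τ ∈ maxElts S₁, θ τ <+: e τ

namespace PruneMap

theorem mono_le (P : PruneMap S₁ S₂) {τ τ' : List (Λ₁ × D)} (h : τ ∈ S₁) (h' : τ' ∈ S₁)
    (hp : τ <+: τ') : P.θ τ <+: P.θ τ' := by
  by_cases he : τ = τ'
  · rw [he]
  · exact (P.mono τ h τ' h' hp he).1

theorem prefix_max (P : PruneMap S₁ S₂) {τ τ' : List (Λ₁ × D)} (h : τ ∈ S₁)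
    (hmax : τ' ∈ maxElts S₁) (hp : τ <+: τ') : P.θ τ <+: P.e τ' :=
  (P.mono_le h hmax.1 hp).trans (P.prefix_e τ' hmax)

/-- Composition of prunings. -/
def comp (Q : PruneMap S₂ S₃) (P : PruneMap S₁ S₂) : PruneMap S₁ S₃ where
  θ := Q.θ ∘ P.θ
  e := Q.e ∘ P.e
  map_mem τ h := Q.map_mem _ (P.map_mem _ h)
  map_max τ h := Q.map_max _ (P.map_max _ h)
  mono τ h τ' h' hp hne :=
    have := P.mono τ h τ' h' hp hne
    Q.mono _ (P.map_mem _ h) _ (P.map_mem _ h') this.1 this.2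
  le_last τ h x hx := by
    obtain ⟨y, hy, hxy⟩ := P.le_last τ h x hx
    obtain ⟨z, hz, hyz⟩ := Q.le_last _ (P.map_mem _ h) y hy
    exact ⟨z, hz, hxy.trans hyz⟩
  prefix_e τ h := Q.prefix_max (P.map_mem _ h.1) (P.map_max _ h) (P.prefix_e τ h)

/-- The identity pruning. -/
def refl (S : Set (List (Λ₁ × D))) : PruneMap S S where
  θ := id
  e := id
  map_mem _ h := h
  map_max _ h := h
  mono _ _ _ _ hp hne := ⟨hp, hne⟩
  le_last _ _ x hx := ⟨x, hx, le_rfl⟩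
  prefix_e _ _ := List.prefix_rfl

/-- The extended pruning given by a `PruneMap`. -/
def toExtPruning (P : PruneMap S₁ S₂) : ExtPruning S₁ S₂ where
  θ τ := ⟨P.θ τ.1, P.map_mem _ τ.2⟩
  e τ := ⟨P.e τ.1, P.map_max _ τ.2⟩
  monotone τ τ' hp hne := P.mono _ τ.2 _ τ'.2 hp hne
  le_last τ x hx y hy := by
    obtain ⟨z, hz, hxz⟩ := P.le_last _ τ.2 x hx
    rw [Option.mem_def] at hy hz
    rw [hy, Option.some_inj] at hz
    exact hz ▸ hxz
  prefix_e τ := P.prefix_e _ τ.2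

end PruneMap

/-- Some pruning `(θ, e)` from `S₁` to `S₂` has all its values `(θ s, e τ)`, for `s ⪯ τ` with `τ`
maximal, in the relation `Ψ`. Being large, and having averages below a bound, are of this form; for
the latter `Ψ` ignores `θ s`. -/
def Prunes (S₁ : Set (List (Λ₁ × D))) (S₂ : Set (List (Λ₂ × D)))
    (Ψ : List (Λ₂ × D) → List (Λ₂ × D) → Prop) : Prop :=
  ∃ P : PruneMap S₁ S₂, ∀ τ ∈ maxElts S₁, ∀ s ∈ S₁, s <+: τ → Ψ (P.θ s) (P.e τ)

namespace Prunes

variable {Ψ Ψ' : List (Λ₂ × D) → List (Λ₂ × D) → Prop}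

theorem mono (h : Prunes S₁ S₂ Ψ)
    (hΨ : ∀ b ∈ maxElts S₂, ∀ s ∈ S₂, s <+: b → Ψ s b → Ψ' s b) : Prunes S₁ S₂ Ψ' := by
  obtain ⟨P, hP⟩ := h
  exact ⟨P, fun τ hτ s hs hp => hΨ _ (P.map_max τ hτ) _ (P.map_mem s hs) (P.prefix_max hs hτ hp)
    (hP τ hτ s hs hp)⟩

theorem precomp {Ψ : List (Λ₃ × D) → List (Λ₃ × D) → Prop} (h : Prunes S₂ S₃ Ψ)
    (P : PruneMap S₁ S₂) : Prunes S₁ S₃ Ψ := by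
  obtain ⟨Q, hQ⟩ := h
  exact ⟨Q.comp P, fun τ hτ s hs hp =>
    hQ _ (P.map_max τ hτ) _ (P.map_mem s hs) (P.prefix_max hs hτ hp)⟩

theorem postcomp {Ψ : List (Λ₃ × D) → List (Λ₃ × D) → Prop} (Q : PruneMap S₂ S₃)
    (h : Prunes S₁ S₂ fun s b => Ψ (Q.θ s) (Q.e b)) : Prunes S₁ S₃ Ψ := by
  obtain ⟨P, hP⟩ := h
  exact ⟨Q.comp P, hP⟩

theorem exists_branch {Φ : List (Λ₂ × D) → Prop} (h : Prunes S₁ S₂ fun _ b => Φ b)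
    (hne : (maxElts S₁).Nonempty) : ∃ b ∈ maxElts S₂, Φ b := by
  obtain ⟨P, hP⟩ := h
  obtain ⟨τ, hτ⟩ := hne
  exact ⟨P.e τ, P.map_max τ hτ, hP τ hτ τ hτ.1 List.prefix_rfl⟩

theorem extend_branches (hT : S₂ ⊆ T) (P : PruneMap S₁ S₂)
    (h : ∀ τ ∈ maxElts S₁, ∃ b ∈ maxElts T, P.e τ <+: b ∧
      ∀ s ∈ S₁, s <+: τ → Ψ (P.θ s) b) : Prunes S₁ T Ψ := by
  classical
  choose! e he using h
  exact ⟨{ P with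
    e := e
    map_mem := fun τ hτ => hT (P.map_mem τ hτ)
    map_max := fun τ hτ => (he τ hτ).1
    prefix_e := fun τ hτ => (P.prefix_e τ hτ).trans (he τ hτ).2.1 }, fun τ hτ => (he τ hτ).2.2⟩

end Prunes

namespace IsComponents

variable {ι : Type*} {A : ι → Set (List (Λ₁ × D))}

/-- The inclusion of a component. -/
def incl (h : IsComponents A S₁) (i : ι) : PruneMap (A i) S₁ where
  θ := id
  e := id
  map_mem _ hτ := h.subset i hτ
  map_max _ hτ := ⟨h.subset i hτ.1, fun s hs hp => hτ.2 s (h.mem_upward hτ.1 hs hp) hp⟩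
  mono _ _ _ _ hp hne := ⟨hp, hne⟩
  le_last _ _ x hx := ⟨x, hx, le_rfl⟩
  prefix_e _ _ := List.prefix_rfl

/-- The pruning glued from prunings of the components. -/
noncomputable def gluePruneMap (h : IsComponents A S₁) (P : ∀ i, PruneMap (A i) S₂) :
    PruneMap S₁ S₂ where
  θ := glue A fun i => (P i).θ
  e := glue A fun i => (P i).e
  map_mem τ hτ := by
    obtain ⟨i, hi⟩ := h.cover τ hτ
    exact h.glue_eq _ hi ▸ (P i).map_mem τ hi
  map_max τ hτ := by
    obtain ⟨i, hi⟩ := h.cover τ hτ.1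
    exact h.glue_eq _ hi ▸ (P i).map_max τ (h.mem_maxElts hi hτ)
  mono τ hτ τ' hτ' hp hne := by
    obtain ⟨i, hi⟩ := h.cover τ hτ
    have hi' := h.mem_upward hi hτ' hp
    rw [h.glue_eq _ hi, h.glue_eq _ hi']
    exact (P i).mono τ hi τ' hi' hp hne
  le_last τ hτ := by
    obtain ⟨i, hi⟩ := h.cover τ hτ
    exact h.glue_eq _ hi ▸ (P i).le_last τ hi
  prefix_e τ hτ := by
    obtain ⟨i, hi⟩ := h.cover τ hτ.1
    rw [h.glue_eq _ hi, h.glue_eq _ hi]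
    exact (P i).prefix_e τ (h.mem_maxElts hi hτ)

variable {Ψ : List (Λ₂ × D) → List (Λ₂ × D) → Prop}

theorem prunes (h : IsComponents A S₁) (hp : ∀ i, Prunes (A i) S₂ Ψ) : Prunes S₁ S₂ Ψ := by
  choose P hP using hp
  refine ⟨h.gluePruneMap P, fun τ hτ s hs hsτ => ?_⟩
  obtain ⟨i, hi⟩ := h.cover τ hτ.1
  have hsi := h.mem_downward hs hi hsτ
  simpa only [gluePruneMap, h.glue_eq _ hi, h.glue_eq _ hsi] using
    hP i τ (h.mem_maxElts hi hτ) s hsi hsτ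

theorem prunes_of_cofinal [LE ι] (h : IsComponents A S₁)
    (emb : ∀ i j, i ≤ j → Nonempty (PruneMap (A i) (A j)))
    (hp : ∀ i, ∃ j, i ≤ j ∧ Prunes (A j) S₂ Ψ) : Prunes S₁ S₂ Ψ := by
  refine h.prunes fun i => ?_
  obtain ⟨j, hij, hj⟩ := hp i
  obtain ⟨P⟩ := emb i j hij
  exact hj.precomp P

theorem prunes_or_prunes [LinearOrder ι] {Ψ' : List (Λ₂ × D) → List (Λ₂ × D) → Prop}
    (h : IsComponents A S₁) (emb : ∀ i j, i ≤ j → Nonempty (PruneMap (A i) (A j)))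
    (hp : ∀ i, Prunes (A i) S₂ Ψ ∨ Prunes (A i) S₂ Ψ') : Prunes S₁ S₂ Ψ ∨ Prunes S₁ S₂ Ψ' := by
  by_cases hΨ : ∀ i, ∃ j, i ≤ j ∧ Prunes (A j) S₂ Ψ
  · exact Or.inl (h.prunes_of_cofinal emb hΨ)
  · push Not at hΨ
    obtain ⟨i, hi⟩ := hΨ
    exact Or.inr (h.prunes_of_cofinal emb fun k =>
      ⟨max i k, le_max_right i k, (hp _).resolve_left (hi _ (le_max_left i k))⟩)

end IsComponents

end Prunings

section Shift

open Ordinal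

variable {D : Type v}

/-- `a + τ`: translation of the ordinal coordinates of `τ`. -/
noncomputable def shiftD (a : Ordinal.{u}) (τ : List (Ordinal.{u} × D)) : List (Ordinal.{u} × D) :=
  τ.map (Prod.map (a + ·) id)

/-- The entries of `τ` with ordinals at least `a`, translated back by `a`: it recovers `s` from
`(a + s) ⌢ w` when the ordinals of `w` are below `a`. -/
noncomputable def headPart (a : Ordinal.{u}) (τ : List (Ordinal.{u} × D)) :
    List (Ordinal.{u} × D) :=
  (τ.filter (a ≤ ·.1)).map (Prod.map (· - a) id)

/-- The entries of `τ` with ordinals below `a`: it recovers `w` from `(a + s) ⌢ w` when the ordinals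
of `w` are below `a`. -/
noncomputable def tailPart (a : Ordinal.{u}) (τ : List (Ordinal.{u} × D)) :
    List (Ordinal.{u} × D) :=
  τ.filter (·.1 < a)

variable {a : Ordinal.{u}} {s t w w' : List (Ordinal.{u} × D)}

theorem le_of_mem_shiftD {x : Ordinal.{u} × D} (h : x ∈ shiftD a s) : a ≤ x.1 := by
  obtain ⟨y, -, rfl⟩ := List.mem_map.1 h
  exact le_self_add

theorem headPart_append (hw : ∀ x ∈ w, x.1 < a) : headPart a (shiftD a s ++ w) = s := by
  have hshift : (shiftD a s).filter (a ≤ ·.1) = shiftD a s :=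
    List.filter_eq_self.2 fun x hx => by simpa using le_of_mem_shiftD hx
  have htail : w.filter (a ≤ ·.1) = [] := List.filter_eq_nil_iff.2 (by simpa using hw)
  rw [headPart, List.filter_append, hshift, htail, List.append_nil, shiftD, List.map_map]
  exact (List.map_congr_left fun x _ => by simp [Prod.map]).trans (List.map_id s)

theorem tailPart_append (hw : ∀ x ∈ w, x.1 < a) : tailPart a (shiftD a s ++ w) = w := by
  have hshift : (shiftD a s).filter (·.1 < a) = [] :=
    List.filter_eq_nil_iff.2 fun x hx => by simpa using le_of_mem_shiftD hx
  have htail : w.filter (·.1 < a) = w := List.filter_eq_self.2 (by simpa using hw)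
  rw [tailPart, List.filter_append, hshift, htail, List.nil_append]

theorem headPart_shiftD : headPart a (shiftD a s) = s := by
  simpa using headPart_append (w := []) (by simp)

theorem tailPart_shiftD : tailPart a (shiftD a s) = [] := by
  simpa using tailPart_append (w := []) (by simp)

theorem shiftD_append_prefix (hw : ∀ x ∈ w, x.1 < a) (hw' : ∀ x ∈ w', x.1 < a)
    (h : shiftD a s ++ w <+: shiftD a t ++ w') : s <+: t ∧ w <+: w' := by
  have hhead : headPart a (shiftD a s ++ w) <+: headPart a (shiftD a t ++ w') :=
    (h.filter _).map _
  have htail : tailPart a (shiftD a s ++ w) <+: tailPart a (shiftD a t ++ w') := h.filter _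
  rw [headPart_append hw, headPart_append hw'] at hhead
  rw [tailPart_append hw, tailPart_append hw'] at htail
  exact ⟨hhead, htail⟩

theorem prefix_of_shiftD_prefix_append (hw : ∀ x ∈ w, x.1 < a)
    (h : shiftD a s <+: shiftD a t ++ w) : s <+: t :=
  (shiftD_append_prefix (w := []) (by simp) hw (by simpa using h)).1

theorem shiftD_prefix_iff : shiftD a s <+: shiftD a t ↔ s <+: t :=
  ⟨fun h => prefix_of_shiftD_prefix_append (w := []) (by simp) (by simpa using h),
    fun h => h.map _⟩

theorem shiftD_injective (a : Ordinal.{u}) :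
    Function.Injective (shiftD a : List (Ordinal.{u} × D) → _) :=
  Function.LeftInverse.injective fun _ => headPart_shiftD

theorem shiftD_zero (s : List (Ordinal.{u} × D)) : shiftD 0 s = s :=
  (List.map_congr_left fun x _ => by simp [Prod.map]).trans (List.map_id s)

theorem mem_getLast?_shiftD {y : Ordinal.{u} × D} :
    y ∈ (shiftD a s).getLast? ↔ ∃ x ∈ s.getLast?, (a + x.1, x.2) = y := by
  simp [shiftD, List.getLast?_map, Prod.map]

theorem shiftD_map_fst (a : Ordinal.{u}) (s : List (Ordinal.{u} × D)) :
    (shiftD a s).map Prod.fst = shift a (s.map Prod.fst) := by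
  simp [shiftD, shift]

theorem exists_shiftD_of_map_fst {r : List Ordinal.{u}} (h : s.map Prod.fst = shift a r) :
    ∃ σ : List (Ordinal.{u} × D), σ.map Prod.fst = r ∧ s = shiftD a σ := by
  induction r generalizing s with
  | nil => exact ⟨[], rfl, List.map_eq_nil_iff.1 h⟩
  | cons x r ih =>
    obtain ⟨y, s', rfl, h1, h2⟩ := List.map_eq_cons_iff.1 h
    obtain ⟨σ, rfl, rfl⟩ := ih h2
    exact ⟨(x, y.2) :: σ, rfl, by simp [shiftD, Prod.map, ← h1]⟩

theorem maxElts_image_shiftD (a : Ordinal.{u}) (S : Set (List (Ordinal.{u} × D))) :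
    maxElts (shiftD a '' S) = shiftD a '' maxElts S := by
  ext τ
  constructor
  · rintro ⟨⟨s, hs, rfl⟩, h⟩
    exact ⟨s, ⟨hs, fun t ht hp =>
      shiftD_injective a (h _ ⟨t, ht, rfl⟩ (shiftD_prefix_iff.2 hp))⟩, rfl⟩
  · rintro ⟨s, ⟨hs, h⟩, rfl⟩
    refine ⟨⟨s, hs, rfl⟩, ?_⟩
    rintro _ ⟨t, ht, rfl⟩ hp
    rw [h t ht (shiftD_prefix_iff.1 hp)]

variable [Preorder D]

/-- The isomorphism of a tree with its translate. -/
noncomputable def shiftMap (a : Ordinal.{u}) (S : Set (List (Ordinal.{u} × D))) :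
    PruneMap S (shiftD a '' S) where
  θ := shiftD a
  e := shiftD a
  map_mem τ h := ⟨τ, h, rfl⟩
  map_max τ h := by rw [maxElts_image_shiftD]; exact ⟨τ, h, rfl⟩
  mono _ _ _ _ hp hne := ⟨shiftD_prefix_iff.2 hp, fun h => hne (shiftD_injective a h)⟩
  le_last _ _ x hx := ⟨_, mem_getLast?_shiftD.2 ⟨x, hx, rfl⟩, le_rfl⟩
  prefix_e _ _ := List.prefix_rfl

/-- The isomorphism of a translated tree with the original. -/
noncomputable def unshiftMap (a : Ordinal.{u}) (S : Set (List (Ordinal.{u} × D))) :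
    PruneMap (shiftD a '' S) S where
  θ := headPart a
  e := headPart a
  map_mem := by
    rintro _ ⟨τ, h, rfl⟩
    rwa [headPart_shiftD]
  map_max := by
    rw [maxElts_image_shiftD]
    rintro _ ⟨τ, h, rfl⟩
    rwa [headPart_shiftD]
  mono := by
    rintro _ ⟨τ, -, rfl⟩ _ ⟨τ', -, rfl⟩ hp hne
    rw [headPart_shiftD, headPart_shiftD]
    exact ⟨shiftD_prefix_iff.1 hp, fun h => hne (by rw [h])⟩
  le_last := by
    rintro _ ⟨τ, -, rfl⟩ x hx
    obtain ⟨y, hy, rfl⟩ := mem_getLast?_shiftD.1 hx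
    exact ⟨y, by rwa [headPart_shiftD], le_rfl⟩
  prefix_e _ _ := List.prefix_rfl

end Shift

section Concat

variable {D : Type v}

/-- `(a + A) ∪ {(a + t) ⌢ w : t ∈ MAX(A), w ∈ B}`. -/
def concatTree (a : Ordinal.{u}) (A B : Set (List (Ordinal.{u} × D))) :
    Set (List (Ordinal.{u} × D)) :=
  shiftD a '' A ∪ {r | ∃ t ∈ maxElts A, ∃ w ∈ B, r = shiftD a t ++ w}

/-- `B` consists of nonempty sequences with ordinals below `a`, so that a member of
`concatTree a A B` splits in only one way. -/
structure IsBelow (a : Ordinal.{u}) (B : Set (List (Ordinal.{u} × D))) : Prop where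
  lt : ∀ w ∈ B, ∀ x ∈ w, x.1 < a
  ne_nil : ∀ w ∈ B, w ≠ []

variable {a a' : Ordinal.{u}} {A A' B B' : Set (List (Ordinal.{u} × D))}
  {b s t w : List (Ordinal.{u} × D)}

theorem IsBelow.not_append_prefix_shiftD (hB : IsBelow a B) (hw : w ∈ B) :
    ¬ shiftD a t ++ w <+: shiftD a s := fun h =>
  hB.ne_nil w hw <| List.prefix_nil.1
    (shiftD_append_prefix (w' := []) (hB.lt w hw) (by simp) (by simpa using h)).2

theorem mem_maxElts_concatTree (hB : IsBelow a B) (ht : t ∈ maxElts A) (hw : w ∈ maxElts B) :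
    shiftD a t ++ w ∈ maxElts (concatTree a A B) := by
  refine ⟨Or.inr ⟨t, ht, w, hw.1, rfl⟩, ?_⟩
  rintro _ (⟨s, -, rfl⟩ | ⟨t', ht', w', hw', rfl⟩) hp
  · exact absurd hp (hB.not_append_prefix_shiftD hw.1)
  · obtain ⟨hpt, hpw⟩ := shiftD_append_prefix (hB.lt w hw.1) (hB.lt w' hw') hp
    rw [ht.2 t' ht'.1 hpt, hw.2 w' hw' hpw]

theorem exists_of_mem_maxElts_concatTree (hB : IsBelow a B) (hne : B.Nonempty)
    (h : s ∈ maxElts (concatTree a A B)) :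
    ∃ t ∈ maxElts A, ∃ w ∈ maxElts B, s = shiftD a t ++ w := by
  obtain ⟨⟨s, hs, rfl⟩ | ⟨t, ht, w, hw, rfl⟩, hmax⟩ := h
  · obtain ⟨w, hw⟩ := hne
    have hs' : s ∈ maxElts A := ⟨hs, fun s' hs' hp =>
      shiftD_injective a (hmax _ (Or.inl ⟨s', hs', rfl⟩) (shiftD_prefix_iff.2 hp))⟩
    have hws := hmax _ (Or.inr ⟨s, hs', w, hw, rfl⟩) (List.prefix_append _ _)
    exact absurd (List.append_right_eq_self.1 hws) (hB.ne_nil w hw)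
  · refine ⟨t, ht, w, ⟨hw, fun w' hw' hp => ?_⟩, rfl⟩
    exact List.append_cancel_left
      (hmax _ (Or.inr ⟨t, ht, w', hw', rfl⟩) ((List.prefix_append_right_inj _).2 hp))

variable [Preorder D]

namespace PruneMap

/-- The embedding `w ↦ (a + b) ⌢ w`, for a fixed maximal `b`. -/
noncomputable def prepend (hB : IsBelow a B) (hb : b ∈ maxElts A) :
    PruneMap B (concatTree a A B) where
  θ w := shiftD a b ++ w
  e w := shiftD a b ++ w
  map_mem w hw := Or.inr ⟨b, hb, w, hw, rfl⟩
  map_max _ hw := mem_maxElts_concatTree hB hb hw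
  mono _ _ _ _ hp hne :=
    ⟨(List.prefix_append_right_inj _).2 hp, fun h => hne (List.append_cancel_left h)⟩
  le_last w hw x hx := ⟨x, by rwa [List.getLast?_append_of_ne_nil _ (hB.ne_nil w hw)], le_rfl⟩
  prefix_e _ _ := List.prefix_rfl

/-- The first component of the concatenation of `P` with prunings `R t`; see `concat`. -/
noncomputable def concatθ (a a' : Ordinal.{u}) (P : PruneMap A A')
    (R : List (Ordinal.{u} × D) → PruneMap B B') (τ : List (Ordinal.{u} × D)) :
    List (Ordinal.{u} × D) :=
  if tailPart a τ = [] then shiftD a' (P.θ (headPart a τ))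
  else shiftD a' (P.e (headPart a τ)) ++ (R (headPart a τ)).θ (tailPart a τ)

/-- The second component of the concatenation of `P` with prunings `R t`; see `concat`. -/
noncomputable def concatE (a a' : Ordinal.{u}) (P : PruneMap A A')
    (R : List (Ordinal.{u} × D) → PruneMap B B') (τ : List (Ordinal.{u} × D)) :
    List (Ordinal.{u} × D) :=
  shiftD a' (P.e (headPart a τ)) ++ (R (headPart a τ)).e (tailPart a τ)

variable {P : PruneMap A A'} {R : List (Ordinal.{u} × D) → PruneMap B B'}

theorem concatθ_shiftD : concatθ a a' P R (shiftD a s) = shiftD a' (P.θ s) := by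
  rw [concatθ, tailPart_shiftD, headPart_shiftD, if_pos rfl]

theorem concatθ_append (hB : IsBelow a B) (hw : w ∈ B) :
    concatθ a a' P R (shiftD a t ++ w) = shiftD a' (P.e t) ++ (R t).θ w := by
  rw [concatθ, tailPart_append (hB.lt w hw), headPart_append (hB.lt w hw), if_neg (hB.ne_nil w hw)]

theorem concatE_append (hB : IsBelow a B) (hw : w ∈ B) :
    concatE a a' P R (shiftD a t ++ w) = shiftD a' (P.e t) ++ (R t).e w := by
  rw [concatE, tailPart_append (hB.lt w hw), headPart_append (hB.lt w hw)]

theorem concatθ_mono (hB : IsBelow a B) (hB' : IsBelow a' B') {τ τ' : List (Ordinal.{u} × D)}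
    (hτ : τ ∈ concatTree a A B) (hτ' : τ' ∈ concatTree a A B) (hp : τ <+: τ') (hne : τ ≠ τ') :
    concatθ a a' P R τ <+: concatθ a a' P R τ' ∧ concatθ a a' P R τ ≠ concatθ a a' P R τ' := by
  rcases hτ with ⟨s, hs, rfl⟩ | ⟨t, ht, w, hw, rfl⟩ <;>
    rcases hτ' with ⟨s', hs', rfl⟩ | ⟨t', ht', w', hw', rfl⟩
  · rw [concatθ_shiftD, concatθ_shiftD]
    have := P.mono s hs s' hs' (shiftD_prefix_iff.1 hp) (ne_of_apply_ne _ hne)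
    exact ⟨shiftD_prefix_iff.2 this.1, (shiftD_injective a').ne this.2⟩
  · rw [concatθ_shiftD, concatθ_append hB hw']
    have hθe := P.prefix_max hs ht' (prefix_of_shiftD_prefix_append (hB.lt w' hw') hp)
    exact ⟨(shiftD_prefix_iff.2 hθe).trans (List.prefix_append _ _), fun h =>
      hB'.not_append_prefix_shiftD ((R t').map_mem w' hw') (s := P.θ s) (t := P.e t') (by rw [h])⟩
  · exact absurd hp (hB.not_append_prefix_shiftD hw)
  · obtain ⟨hpt, hpw⟩ := shiftD_append_prefix (hB.lt w hw) (hB.lt w' hw') hp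
    obtain rfl := ht.2 t' ht'.1 hpt
    rw [concatθ_append hB hw, concatθ_append hB hw']
    have := (R t').mono w hw w' hw' hpw (ne_of_apply_ne _ hne)
    exact ⟨(List.prefix_append_right_inj _).2 this.1, fun h => this.2 (List.append_cancel_left h)⟩

/-- The concatenation of a pruning `P` with prunings `R t`, one for each maximal `t` of its domain:
`a + s` goes to `a' + θ_P(s)`, and `(a + t) ⌢ w` to `(a' + e_P(t)) ⌢ θ_{R t}(w)`. -/
noncomputable def concat (hB : IsBelow a B) (hB' : IsBelow a' B') (hne : B.Nonempty)
    (P : PruneMap A A') (R : List (Ordinal.{u} × D) → PruneMap B B') :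
    PruneMap (concatTree a A B) (concatTree a' A' B') where
  θ := concatθ a a' P R
  e := concatE a a' P R
  map_mem := by
    rintro _ (⟨s, hs, rfl⟩ | ⟨t, ht, w, hw, rfl⟩)
    · exact Or.inl ⟨_, P.map_mem s hs, concatθ_shiftD.symm⟩
    · exact Or.inr ⟨_, P.map_max t ht, _, (R t).map_mem w hw, concatθ_append hB hw⟩
  map_max τ hτ := by
    obtain ⟨t, ht, w, hw, rfl⟩ := exists_of_mem_maxElts_concatTree hB hne hτ
    rw [concatE_append hB hw.1]
    exact mem_maxElts_concatTree hB' (P.map_max t ht) ((R t).map_max w hw)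
  mono _ hτ _ hτ' := concatθ_mono hB hB' hτ hτ'
  le_last := by
    rintro _ (⟨s, hs, rfl⟩ | ⟨t, -, w, hw, rfl⟩) x hx
    · rw [concatθ_shiftD]
      obtain ⟨y, hy, rfl⟩ := mem_getLast?_shiftD.1 hx
      obtain ⟨z, hz, hyz⟩ := P.le_last s hs y hy
      exact ⟨_, mem_getLast?_shiftD.2 ⟨z, hz, rfl⟩, hyz⟩
    · rw [List.getLast?_append_of_ne_nil _ (hB.ne_nil w hw)] at hx
      rw [concatθ_append hB hw,
        List.getLast?_append_of_ne_nil _ (hB'.ne_nil _ ((R t).map_mem w hw))]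
      exact (R t).le_last w hw x hx
  prefix_e τ hτ := by
    obtain ⟨t, -, w, hw, rfl⟩ := exists_of_mem_maxElts_concatTree hB hne hτ
    rw [concatE_append hB hw.1, concatθ_append hB hw.1]
    exact (List.prefix_append_right_inj _).2 ((R t).prefix_e w hw)

end PruneMap

theorem Prunes.concat {Ψ : List (Ordinal.{u} × D) → List (Ordinal.{u} × D) → Prop}
    (hB : IsBelow a B) (hB' : IsBelow a' B') (hne : B.Nonempty) (hA : (maxElts A).Nonempty)
    (P : PruneMap A A')
    (h : ∀ t ∈ maxElts A, Prunes B B' fun r w =>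
      (∀ s ∈ A, s <+: t → Ψ (shiftD a' (P.θ s)) (shiftD a' (P.e t) ++ w)) ∧
        Ψ (shiftD a' (P.e t) ++ r) (shiftD a' (P.e t) ++ w)) :
    Prunes (concatTree a A B) (concatTree a' A' B') Ψ := by
  obtain ⟨t₀, ht₀⟩ := hA
  have : Nonempty (PruneMap B B') := (h t₀ ht₀).nonempty
  choose! R hR using h
  refine ⟨PruneMap.concat hB hB' hne P R, fun τ hτ σ hσ hp => ?_⟩
  obtain ⟨t, ht, w, hw, rfl⟩ := exists_of_mem_maxElts_concatTree hB hne hτ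
  simp only [PruneMap.concat, PruneMap.concatE_append hB hw.1]
  rcases hσ with ⟨s, hs, rfl⟩ | ⟨t', ht', r, hr, rfl⟩
  · rw [PruneMap.concatθ_shiftD]
    exact (hR t ht w hw w hw.1 List.prefix_rfl).1 s hs
      (prefix_of_shiftD_prefix_append (hB.lt w hw.1) hp)
  · obtain ⟨hpt, hpr⟩ := shiftD_append_prefix (hB.lt r hr) (hB.lt w hw.1) hp
    obtain rfl := ht'.2 t ht.1 hpt
    rw [PruneMap.concatθ_append hB hr]
    exact (hR t ht w hw r hr hpr).2

end Concat

section Levels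

open Ordinal

variable {Λ : Type*} {D : Type v}

theorem map_fst_mem_maxElts {T : Set (List Λ)} {τ : List (Λ × D)} (hT : [] ∉ T)
    (h : τ ∈ maxElts (treeProd T D)) : τ.map Prod.fst ∈ maxElts T := by
  refine ⟨h.1, ?_⟩
  rintro _ hs ⟨r, rfl⟩
  obtain ⟨x, -, -⟩ := List.exists_cons_of_ne_nil (show τ ≠ [] by rintro rfl; exact hT h.1)
  have hmax := h.2 (τ ++ r.map fun y => (y, x.2))
    (by simpa [treeProd, Function.comp_def] using hs) (List.prefix_append _ _)
  have hr : r = [] := by simpa using hmax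
  rw [hr, List.append_nil]

theorem mem_maxElts_treeProd {T : Set (List Λ)} {τ : List (Λ × D)}
    (h : τ.map Prod.fst ∈ maxElts T) : τ ∈ maxElts (treeProd T D) := by
  refine ⟨h.1, ?_⟩
  rintro _ hs ⟨r, rfl⟩
  have hmax := h.2 _ hs (by simp)
  have hr : r = [] := by simpa using hmax
  rw [hr, List.append_nil]

theorem maxElts_Omg_nonempty [Nonempty D] (ξ : Ordinal.{u}) : (maxElts (Omg ξ D)).Nonempty := by
  obtain ⟨d⟩ := ‹Nonempty D›
  obtain ⟨⟨s, hs⟩, h⟩ := exists_weight ξ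
  obtain ⟨t, ht, -⟩ := h s hs
  exact ⟨t.map (·, d), mem_maxElts_treeProd (by simpa [Function.comp_def] using ht)⟩

/-- `Ω_{ξ,n} = Γ_{ξ,n} D`, so that `Ω_{ξ+1}` is the union of the `Ω_{ξ,n}`. -/
def levelOmg (ξ : Ordinal.{u}) (D : Type v) (n : ℕ) : Set (List (Ordinal.{u} × D)) :=
  treeProd (gammaLevel ξ (Gam ξ) n) D

theorem levelOmg_one (ξ : Ordinal.{u}) : levelOmg ξ D 1 = Omg ξ D := by
  rw [levelOmg, gammaLevel_one, Omg]

theorem levelOmg_succ (ξ : Ordinal.{u}) (n : ℕ) :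
    levelOmg ξ D (n + 1) = concatTree (omega0 ^ ξ * n) (Omg ξ D) (levelOmg ξ D n) := by
  ext τ
  constructor
  · rintro (⟨s, hs, h⟩ | ⟨t, ht, w, hw, h⟩)
    · obtain ⟨σ, rfl, rfl⟩ := exists_shiftD_of_map_fst h
      exact Or.inl ⟨σ, hs, rfl⟩
    · obtain ⟨τ₁, τ₂, rfl, h1, rfl⟩ := List.map_eq_append_iff.1 h
      obtain ⟨σ, rfl, rfl⟩ := exists_shiftD_of_map_fst h1
      exact Or.inr ⟨σ, mem_maxElts_treeProd ht, τ₂, hw, rfl⟩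
  · rintro (⟨s, hs, rfl⟩ | ⟨t, ht, w, hw, rfl⟩)
    · exact Or.inl ⟨_, hs, shiftD_map_fst _ _⟩
    · refine Or.inr ⟨_, map_fst_mem_maxElts (isBTree_Gam ξ).1 ht, _, hw, ?_⟩
      rw [List.map_append, shiftD_map_fst]

theorem isBelow_levelOmg (ξ : Ordinal.{u}) (n : ℕ) :
    IsBelow (omega0 ^ ξ * n) (levelOmg ξ D n) where
  lt w hw x hx := gammaLevel_lt (Gam_lt ξ) n _ hw _ (List.mem_map_of_mem hx)
  ne_nil := by
    rintro w hw rfl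
    exact (isBTree_gammaLevel (isBTree_Gam ξ) n).1 hw

theorem maxElts_levelOmg_nonempty [Nonempty D] (ξ : Ordinal.{u}) {n : ℕ} (hn : 1 ≤ n) :
    (maxElts (levelOmg ξ D n)).Nonempty := by
  obtain ⟨b, hb⟩ := maxElts_Omg_nonempty (D := D) ξ
  induction n, hn using Nat.le_induction with
  | base => exact ⟨b, levelOmg_one (D := D) ξ ▸ hb⟩
  | succ n _ ih =>
    obtain ⟨w, hw⟩ := ih
    rw [levelOmg_succ]
    exact ⟨_, mem_maxElts_concatTree (isBelow_levelOmg ξ n) hb hw⟩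

theorem gammaLevel_head {ξ : Ordinal.{u}} (n : ℕ) :
    ∀ τ ∈ gammaLevel ξ (Gam ξ) n, ∃ x l, τ = x :: l ∧ x / omega0 ^ ξ + 1 = n := by
  have hp := (opow_pos ξ omega0_pos).ne'
  rcases n with _ | n
  · simp [gammaLevel]
  · have key : ∀ s ∈ Gam ξ, ∀ r, ∃ x l, shift (omega0 ^ ξ * n) s ++ r = x :: l ∧
        x / omega0 ^ ξ + 1 = (n + 1 : ℕ) := by
      intro s hs r
      obtain ⟨x, l, rfl⟩ := List.exists_cons_of_ne_nil (ne_of_mem_of_not_mem hs (isBTree_Gam ξ).1)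
      refine ⟨_, _, rfl, ?_⟩
      rw [mul_add_div _ hp, div_eq_zero_of_lt (Gam_lt ξ _ hs x (by simp)), add_zero, Nat.cast_succ]
    rintro _ (⟨s, hs, rfl⟩ | ⟨t, ht, w, -, rfl⟩)
    · simpa using key s hs []
    · exact key t ht.1 w

theorem isComponents_of_map_fst {ι β : Type*} {T : Set (List Λ)} {A : ι → Set (List Λ)}
    (hT : T = ⋃ i, A i) (f : Λ → β) {g : ι → β} (hg : Function.Injective g)
    (hf : ∀ i, ∀ t ∈ A i, ∃ x l, t = x :: l ∧ f x = g i) :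
    IsComponents (fun i => treeProd (A i) D) (treeProd T D) where
  subset i τ h := hT.ge (Set.mem_iUnion_of_mem i h)
  cover τ (h : τ.map Prod.fst ∈ T) := (Set.mem_iUnion (s := A)).1 (hT.le h)
  sep i j τ hτ τ' hτ' hp := by
    obtain ⟨x, l, h1, hx⟩ := hf i _ hτ
    obtain ⟨y, l', h2, hy⟩ := hf j _ hτ'
    have hxy := hp.map Prod.fst
    rw [h1, h2, List.cons_prefix_cons] at hxy
    exact hg (by rw [← hx, ← hy, hxy.1])

theorem isComponents_add_one (ξ : Ordinal.{u}) : IsComponents (levelOmg ξ D) (Omg (ξ + 1) D) :=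
  isComponents_of_map_fst (Gam_add_one ξ) (· / omega0 ^ ξ + 1) Nat.cast_injective gammaLevel_head

theorem treeProd_image_shift (a : Ordinal.{u}) (T : Set (List Ordinal.{u})) :
    treeProd (shift a '' T) D = shiftD a '' treeProd T D := by
  ext τ
  constructor
  · rintro ⟨s, hs, h⟩
    obtain ⟨σ, rfl, rfl⟩ := exists_shiftD_of_map_fst h.symm
    exact ⟨σ, hs, rfl⟩
  · rintro ⟨σ, hσ, rfl⟩
    exact ⟨_, hσ, (shiftD_map_fst a σ).symm⟩

theorem isComponents_limit {ξ : Ordinal.{u}} (hξ : Order.IsSuccLimit ξ) :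
    IsComponents (fun ζ : Set.Iio ξ => shiftD (omega0 ^ ζ.1) '' Omg (ζ.1 + 1) D) (Omg ξ D) := by
  simp only [Omg, ← treeProd_image_shift]
  refine isComponents_of_map_fst (A := fun ζ : Set.Iio ξ => shift (omega0 ^ ζ.1) '' Gam (ζ.1 + 1))
    (by ext; simp [Gam_limit hξ]) (Ordinal.log omega0) Subtype.val_injective ?_
  rintro ⟨ζ, hζ⟩ _ ⟨t, ht, rfl⟩
  obtain ⟨x, l, rfl⟩ := List.exists_cons_of_ne_nil (ne_of_mem_of_not_mem ht (isBTree_Gam _).1)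
  exact ⟨_, _, rfl, log_opow_add ζ x (Gam_lt _ _ ht x (by simp))⟩

theorem exists_of_mem_Omg_zero {τ : List (Ordinal.{u} × D)} (h : τ ∈ Omg 0 D) :
    ∃ d, τ = [(0, d)] := by
  have h' : τ.map Prod.fst ∈ Gam 0 := h
  rw [Gam_zero, Set.mem_singleton_iff] at h'
  obtain ⟨⟨x, d⟩, l, rfl, rfl, hl⟩ := List.map_eq_cons_iff.1 h'
  exact ⟨d, by rw [List.map_eq_nil_iff.1 hl]⟩

theorem singleton_mem_maxElts_Omg_zero (d : D) : [((0 : Ordinal.{u}), d)] ∈ maxElts (Omg 0 D) := by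
  refine mem_maxElts_treeProd ⟨by simp [Gam_zero], ?_⟩
  intro s hs _
  rw [Gam_zero, Set.mem_singleton_iff] at hs
  simp [hs]

variable [Preorder D]

theorem nonempty_pruneMap_Omg {ζ ξ : Ordinal.{u}} (h : ζ ≤ ξ) :
    Nonempty (PruneMap (Omg ζ D) (Omg ξ D)) := by
  have add_one (ξ : Ordinal.{u}) : Nonempty (PruneMap (Omg ξ D) (Omg (ξ + 1) D)) := by
    rw [← levelOmg_one ξ]
    exact ⟨(isComponents_add_one ξ).incl 1⟩
  induction ξ using Ordinal.limitRecOn with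
  | zero =>
    obtain rfl : ζ = 0 := le_antisymm h zero_le
    exact ⟨PruneMap.refl _⟩
  | add_one ξ ih =>
    rcases h.eq_or_lt with rfl | h
    · exact ⟨PruneMap.refl _⟩
    · obtain ⟨P⟩ := ih (Order.lt_add_one_iff.1 h)
      obtain ⟨Q⟩ := add_one ξ
      exact ⟨Q.comp P⟩
  | limit ξ hξ ih =>
    rcases h.eq_or_lt with rfl | h
    · exact ⟨PruneMap.refl _⟩
    · obtain ⟨P⟩ := add_one ζ
      exact ⟨((isComponents_limit hξ).incl ⟨ζ, h⟩).comp ((shiftMap _ _).comp P)⟩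

theorem nonempty_pruneMap_levelOmg [Nonempty D] (ξ : Ordinal.{u}) {m n : ℕ} (h : m ≤ n) :
    Nonempty (PruneMap (levelOmg ξ D m) (levelOmg ξ D n)) := by
  obtain ⟨b, hb⟩ := maxElts_Omg_nonempty (D := D) ξ
  induction n, h using Nat.le_induction with
  | base => exact ⟨PruneMap.refl _⟩
  | succ n _ ih =>
    obtain ⟨P⟩ := ih
    exact levelOmg_succ (D := D) ξ n ▸ ⟨(PruneMap.prepend (isBelow_levelOmg ξ n) hb).comp P⟩

end Levels

section Weights

open Ordinal

theorem HasWeight.nonneg {ξ : Ordinal.{u}} {s t : List Ordinal.{u}} {w : ℝ}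
    (h : HasWeight ξ s t w) : 0 ≤ w := by
  induction h with
  | zero => exact zero_le_one
  | add_one _ _ _ _ _ _ _ _ _ _ ih => positivity
  | limit _ _ _ _ _ _ _ _ ih => exact ih

theorem prob_nonneg (ξ : Ordinal.{u}) (s : List Ordinal.{u}) : 0 ≤ prob ξ s := by
  rw [prob]
  split_ifs with h
  · obtain ⟨t, ht⟩ := h.choose_spec
    exact ht.nonneg
  · exact le_rfl

theorem prob_zero : prob.{u} 0 [0] = 1 := HasWeight.zero.prob_eq

theorem prob_limit {ξ ζ : Ordinal.{u}} (hξ : Order.IsSuccLimit ξ) (hζ : ζ < ξ)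
    {s : List Ordinal.{u}} (hs : s ∈ Gam (ζ + 1)) :
    prob ξ (shift (omega0 ^ ζ) s) = prob (ζ + 1) s := by
  obtain ⟨t, -, w, hw⟩ := (exists_weight (ζ + 1)).2 s hs
  rw [hw.prob_eq, (HasWeight.limit ξ ζ s t w hξ hζ hw).prob_eq]

theorem prob_levelConcat {ξ : Ordinal.{u}} {l : List (List Ordinal.{u})} {n : ℕ}
    {s : List Ordinal.{u}} (hl : ∀ x ∈ l, x ∈ maxElts (Gam ξ)) (hn : l.length < n)
    (hs : s ∈ Gam ξ) : prob (ξ + 1) (levelConcat ξ n (l ++ [s])) = prob ξ s / n := by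
  obtain ⟨t, ht, w, hw⟩ := (exists_weight ξ).2 s hs
  have hmax : ∀ x ∈ l ++ t :: List.replicate (n - l.length - 1) t, x ∈ maxElts (Gam ξ) := by
    simp only [List.mem_append, List.mem_cons, List.mem_replicate]
    rintro x (hx | rfl | ⟨-, rfl⟩)
    exacts [hl x hx, ht, ht]
  have hlen : (l ++ t :: List.replicate (n - l.length - 1) t).length = n := by
    simp only [List.length_append, List.length_cons, List.length_replicate]
    omega
  rw [(HasWeight.add_one ξ l t _ n s w hlen.symm hmax hw).prob_eq, hw.prob_eq]

theorem exists_levelConcat {ξ : Ordinal.{u}} {G : Set (List Ordinal.{u})} (n : ℕ) :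
    ∀ s ∈ gammaLevel ξ G n, ∃ l s', (∀ x ∈ l, x ∈ maxElts G) ∧
      s' ∈ G ∧ l.length < n ∧ s = levelConcat ξ n (l ++ [s']) := by
  induction n with
  | zero => simp [gammaLevel]
  | succ n ih =>
    rintro s (⟨t, ht, rfl⟩ | ⟨t, ht, v, hv, rfl⟩)
    · exact ⟨[], t, by simp, ht, by simp, by simp [levelConcat]⟩
    · obtain ⟨l, s', hl, hs', hlen, rfl⟩ := ih v hv
      exact ⟨t :: l, s', by simpa using ⟨ht, hl⟩, hs', by simpa using hlen, rfl⟩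

theorem prob_shift {ξ : Ordinal.{u}} {s : List Ordinal.{u}} (hs : s ∈ Gam ξ) (n : ℕ) :
    (n + 1 : ℝ) * prob (ξ + 1) (shift (omega0 ^ ξ * n) s) = prob ξ s := by
  have h := prob_levelConcat (l := []) (n := n + 1) (by simp) (by simp) hs
  simp only [List.nil_append, levelConcat, List.append_nil] at h
  rw [h]
  push_cast
  field_simp

theorem prob_shift_append {ξ : Ordinal.{u}} {t s : List Ordinal.{u}} {n : ℕ}
    (ht : t ∈ maxElts (Gam ξ)) (hs : s ∈ gammaLevel ξ (Gam ξ) n) :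
    (n + 1 : ℝ) * prob (ξ + 1) (shift (omega0 ^ ξ * n) t ++ s) = n * prob (ξ + 1) s := by
  obtain ⟨l, s', hl, hs', hlen, rfl⟩ := exists_levelConcat n s hs
  have h := prob_levelConcat (l := t :: l) (n := n + 1) (by simpa using ⟨ht, hl⟩)
    (by simpa using hlen) hs'
  rw [List.cons_append, levelConcat] at h
  rw [h, prob_levelConcat hl hlen hs']
  have hn : (n : ℝ) ≠ 0 := Nat.cast_ne_zero.2 (by omega)
  push_cast
  field_simp

variable {D : Type v} {ξ : Ordinal.{u}} {b w : List (Ordinal.{u} × D)}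

/-- The average of `f` over the nonempty initial segments of `b` with the weights `ℙ_ξ`; for maximal
`b` and `f = g(·, b)` it is `branchAvg g b`. -/
noncomputable def wavg (ξ : Ordinal.{u}) (b : List (Ordinal.{u} × D))
    (f : List (Ordinal.{u} × D) → ℝ) : ℝ :=
  ∑ i ∈ Finset.range b.length, prob ξ ((b.take (i + 1)).map Prod.fst) * f (b.take (i + 1))

theorem IsBTree.take_succ_mem {α : Type*} {T : Set (List α)} (hT : IsBTree T) {t : List α}
    (ht : t ∈ T) {i : ℕ} (hi : i ∈ Finset.range t.length) : t.take (i + 1) ∈ T := by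
  refine hT.2 t ht _ ?_ (List.take_prefix _ _)
  have := Finset.mem_range.1 hi
  simp only [ne_eq, List.take_eq_nil_iff]
  rintro (h | rfl)
  · omega
  · simp at this

theorem wavg_le (hb : b ∈ Omg ξ D) {f f' : List (Ordinal.{u} × D) → ℝ}
    (h : ∀ s ∈ Omg ξ D, s <+: b → f s ≤ f' s) : wavg ξ b f ≤ wavg ξ b f' :=
  Finset.sum_le_sum fun _ hi => mul_le_mul_of_nonneg_left
    (h _ ((isBTree_Omg ξ D).take_succ_mem hb hi) (List.take_prefix _ _)) (prob_nonneg _ _)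

theorem wavg_add (ξ : Ordinal.{u}) (b : List (Ordinal.{u} × D))
    (f f' : List (Ordinal.{u} × D) → ℝ) :
    wavg ξ b (fun s => f s + f' s) = wavg ξ b f + wavg ξ b f' := by
  simp only [wavg, mul_add, Finset.sum_add_distrib]

theorem wavg_shiftD {a η : Ordinal.{u}} {c : ℝ}
    (h : ∀ s ∈ Gam ξ, c * prob η (shift a s) = prob ξ s) (hb : b ∈ Omg ξ D)
    (f : List (Ordinal.{u} × D) → ℝ) :
    c * wavg η (shiftD a b) f = wavg ξ b fun s => f (shiftD a s) := by
  have hlen : (shiftD a b).length = b.length := List.length_map _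
  rw [wavg, wavg, hlen, Finset.mul_sum]
  refine Finset.sum_congr rfl fun i hi => ?_
  have htake : (shiftD a b).take (i + 1) = shiftD a (b.take (i + 1)) := List.map_take.symm
  rw [htake, shiftD_map_fst, ← mul_assoc, h _ ((isBTree_Omg ξ D).take_succ_mem hb hi)]

theorem wavg_limit {ζ : Ordinal.{u}} (hξ : Order.IsSuccLimit ξ) (hζ : ζ < ξ)
    (hb : b ∈ Omg (ζ + 1) D) (f : List (Ordinal.{u} × D) → ℝ) :
    wavg ξ (shiftD (omega0 ^ ζ) b) f = wavg (ζ + 1) b fun s => f (shiftD (omega0 ^ ζ) s) := by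
  simpa only [one_mul] using
    wavg_shiftD (c := 1) (fun s hs => by rw [one_mul, prob_limit hξ hζ hs]) hb f

theorem wavg_add_one (hb : b ∈ Omg ξ D) (f : List (Ordinal.{u} × D) → ℝ) :
    wavg (ξ + 1) b f = wavg ξ b f := by
  simpa [shiftD_zero] using wavg_shiftD (fun s hs => prob_shift hs 0) hb f

theorem wavg_append (u w : List (Ordinal.{u} × D)) (f : List (Ordinal.{u} × D) → ℝ) :
    wavg ξ (u ++ w) f = wavg ξ u f + ∑ i ∈ Finset.range w.length,
      prob ξ ((u ++ w.take (i + 1)).map Prod.fst) * f (u ++ w.take (i + 1)) := by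
  rw [wavg, List.length_append, Finset.sum_range_add, wavg]
  congr 1
  · refine Finset.sum_congr rfl fun i hi => ?_
    rw [List.take_append_of_le_length (Finset.mem_range.1 hi)]
  · refine Finset.sum_congr rfl fun i _ => ?_
    rw [add_assoc, List.take_length_add_append]

theorem wavg_shiftD_append {n : ℕ} (hb : b ∈ maxElts (Omg ξ D)) (hw : w ∈ levelOmg ξ D n)
    (f : List (Ordinal.{u} × D) → ℝ) :
    (n + 1 : ℝ) * wavg (ξ + 1) (shiftD (omega0 ^ ξ * n) b ++ w) f =
      wavg ξ b (fun s => f (shiftD (omega0 ^ ξ * n) s)) +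
        n * wavg (ξ + 1) w fun r => f (shiftD (omega0 ^ ξ * n) b ++ r) := by
  rw [wavg_append, mul_add, wavg_shiftD (fun s hs => prob_shift hs n) hb.1]
  congr 1
  rw [wavg, Finset.mul_sum, Finset.mul_sum]
  refine Finset.sum_congr rfl fun i hi => ?_
  have hmem : (w.take (i + 1)).map Prod.fst ∈ gammaLevel ξ (Gam ξ) n := by
    rw [List.map_take]
    exact (isBTree_gammaLevel (isBTree_Gam ξ) n).take_succ_mem hw (by simpa using hi)
  rw [List.map_append, shiftD_map_fst, ← mul_assoc, ← mul_assoc,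
    prob_shift_append (map_fst_mem_maxElts (isBTree_Gam ξ).1 hb) hmem]

theorem wavg_const_levelOmg [Nonempty D] {c : ℝ}
    (hξ : ∀ b ∈ maxElts (Omg ξ D), wavg ξ b (fun _ => c) = c) {n : ℕ} (hn : 1 ≤ n) :
    ∀ b ∈ maxElts (levelOmg ξ D n), wavg (ξ + 1) b (fun _ => c) = c := by
  induction n, hn using Nat.le_induction with
  | base =>
    intro b hb
    rw [levelOmg_one] at hb
    rw [wavg_add_one hb.1, hξ b hb]
  | succ n hn ih =>
    intro τ hτ
    rw [levelOmg_succ] at hτ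
    obtain ⟨b, hb, w, hw, rfl⟩ := exists_of_mem_maxElts_concatTree (isBelow_levelOmg ξ n)
      ((maxElts_levelOmg_nonempty ξ hn).mono fun _ => And.left) hτ
    have h := wavg_shiftD_append hb hw.1 fun _ => c
    rw [hξ b hb, ih w hw] at h
    exact mul_left_cancel₀ (Nat.cast_add_one_ne_zero n) (h.trans (by ring))

theorem wavg_const [Nonempty D] (hb : b ∈ maxElts (Omg ξ D)) (c : ℝ) :
    wavg ξ b (fun _ => c) = c := by
  induction ξ using Ordinal.limitRecOn generalizing b with
  | zero =>
    obtain ⟨d, rfl⟩ := exists_of_mem_Omg_zero hb.1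
    simp [wavg, prob_zero]
  | add_one ξ ih =>
    obtain ⟨n, hn⟩ := (isComponents_add_one ξ).cover b hb.1
    rcases n.eq_zero_or_pos with rfl | hpos
    · exact absurd hn (Set.notMem_empty b)
    · exact wavg_const_levelOmg (fun _ => ih) hpos b ((isComponents_add_one ξ).mem_maxElts hn hb)
  | limit ξ hξ ih =>
    obtain ⟨⟨ζ, hζ⟩, hbζ⟩ := (isComponents_limit hξ).cover b hb.1
    have hmax := (isComponents_limit hξ).mem_maxElts hbζ hb
    rw [maxElts_image_shiftD] at hmax
    obtain ⟨τ, hτ, rfl⟩ := hmax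
    rw [wavg_limit hξ hζ hτ.1]
    exact ih _ (hξ.add_one_lt hζ) hτ

theorem wavg_le_const [Nonempty D] (hb : b ∈ maxElts (Omg ξ D))
    {f : List (Ordinal.{u} × D) → ℝ} {c : ℝ} (hf : ∀ s, f s ≤ c) : wavg ξ b f ≤ c :=
  (wavg_le hb.1 fun s _ _ => hf s).trans_eq (wavg_const hb c)

theorem wavg_le_of_approx [Nonempty D] (hb : b ∈ maxElts (Omg ξ D))
    {f f' : List (Ordinal.{u} × D) → ℝ} {η : ℝ}
    (h : ∀ s ∈ Omg ξ D, s <+: b → f s ≤ f' s + η) : wavg ξ b f ≤ wavg ξ b f' + η :=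
  calc
    wavg ξ b f ≤ wavg ξ b fun s => f' s + η := wavg_le hb.1 h
    _ = wavg ξ b f' + η := by rw [wavg_add, wavg_const hb]

end Weights

section Dichotomy

open Ordinal

variable {D : Type v} [Preorder D] {ξ : Ordinal.{u}}

/-- The theorem at `ξ` for bounded real functions defined on all pairs of sequences, with the slack
`δ` of largeness fixed in advance: some pruning either has all values at least `c - δ` or has all
averages below `c`. -/
def Dichotomy (ξ : Ordinal.{u}) (D : Type v) [Preorder D] : Prop :=
  ∀ (F : List (Ordinal.{u} × D) → List (Ordinal.{u} × D) → ℝ) (C : ℝ), (∀ s b, |F s b| ≤ C) →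
    ∀ c δ : ℝ, 0 < δ → Prunes (Omg ξ D) (Omg ξ D) (fun s b => c - δ ≤ F s b) ∨
      Prunes (Omg ξ D) (Omg ξ D) fun _ b => wavg ξ b (F · b) < c

namespace Dichotomy

variable {Λ K : Type*} {T : Set (List (Λ × D))} {Ψ : List (Λ × D) → List (Λ × D) → Prop}

theorem split [Nonempty D] (h : Dichotomy ξ D) (hΨ : Prunes (Omg ξ D) T Ψ)
    (V : List (Λ × D) → Prop) :
    Prunes (Omg ξ D) T (fun s b => Ψ s b ∧ V b) ∨ Prunes (Omg ξ D) T fun s b => Ψ s b ∧ ¬ V b := by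
  classical
  obtain ⟨P, hP⟩ := hΨ
  -- A function of the branch alone equals its average, so smallness of an indicator means `¬ V`.
  refine (h (fun _ b => if V (P.e b) then 1 else 0) 1 (fun _ b => ?_) 1 (1 / 2) (by norm_num)).imp
    (fun hV => .postcomp P (hV.mono fun b hb s hs hp hsb => ⟨hP b hb s hs hp, ?_⟩))
    (fun hV => .postcomp P (hV.mono fun b hb s hs hp hsb => ⟨hP b hb s hs hp, fun hVb => ?_⟩))
  · split_ifs <;> simp
  · by_contra hVb
    rw [if_neg hVb] at hsb
    norm_num at hsb
  · rw [wavg_const hb, if_pos hVb] at hsb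
    exact lt_irrefl _ hsb

theorem exists_monochromatic [Nonempty D] (h : Dichotomy ξ D) (hΨ : Prunes (Omg ξ D) T Ψ)
    {κ : List (Λ × D) → K} (hκ : (Set.range κ).Finite) :
    ∃ b₀, Prunes (Omg ξ D) T fun s b => Ψ s b ∧ κ b = κ b₀ := by
  suffices key : ∀ K' : Set K, K'.Finite →
      Prunes (Omg ξ D) T (fun s b => Ψ s b ∧ κ b ∈ K') →
        ∃ b₀, Prunes (Omg ξ D) T fun s b => Ψ s b ∧ κ b = κ b₀ from
    key _ hκ (hΨ.mono fun b _ _ _ _ hsb => ⟨hsb, b, rfl⟩)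
  intro K' hK'
  induction K', hK' using Set.Finite.induction_on with
  | empty =>
    rintro ⟨P, hP⟩
    obtain ⟨τ, hτ⟩ := maxElts_Omg_nonempty (D := D) ξ
    exact absurd (hP τ hτ τ hτ.1 List.prefix_rfl).2 (Set.notMem_empty _)
  | @insert k K' _ _ ih =>
    intro hk
    rcases h.split hk (κ · = k) with ⟨P, hP⟩ | hne
    · obtain ⟨τ, hτ⟩ := maxElts_Omg_nonempty (D := D) ξ
      refine ⟨P.e τ, P, fun t ht s hs hp => ⟨(hP t ht s hs hp).1.1, ?_⟩⟩
      rw [(hP t ht s hs hp).2, (hP τ hτ τ hτ.1 List.prefix_rfl).2]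
    · exact ih (hne.mono fun _ _ _ _ _ hsb =>
        ⟨hsb.1.1, (Set.mem_insert_iff.1 hsb.1.2).resolve_left hsb.2⟩)

end Dichotomy

/-- The outcome at `Ω_{ξ,n}` when `j` of its `n` stages are large: `F` is at least `c - δ` along a
pruning of `Ω_{ξ,j}`, and along a pruning of `Ω_{ξ,n}` the averages of `F` are at most what results
from the bound `C` at the large stages and `c` at the others. All branches chosen lie in `Φ`. -/
structure HasLargeLevels (ξ : Ordinal.{u}) (n j : ℕ)
    (F : List (Ordinal.{u} × D) → List (Ordinal.{u} × D) → ℝ) (C c δ : ℝ)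
    (Φ : List (Ordinal.{u} × D) → Prop) : Prop where
  large : 0 < j → Prunes (levelOmg ξ D j) (levelOmg ξ D n) fun s b => c - δ ≤ F s b ∧ Φ b
  avg : Prunes (levelOmg ξ D n) (levelOmg ξ D n) fun _ b =>
    n * wavg (ξ + 1) b (F · b) ≤ j * C + (n - j) * c ∧ Φ b

/-- For every function `F` bounded by `C` and every finite colouring, some number `j ≤ n` of large
stages occurs along branches of a single colour. -/
def LevelDichotomy (ξ : Ordinal.{u}) (D : Type v) [Preorder D] (n : ℕ) : Prop :=
  ∀ (F : List (Ordinal.{u} × D) → List (Ordinal.{u} × D) → ℝ) (C : ℝ), (∀ s b, |F s b| ≤ C) →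
    ∀ c δ : ℝ, 0 < δ → ∀ (K : Type max (u + 1) v) (κ : List (Ordinal.{u} × D) → K),
      (Set.range κ).Finite → ∃ j ≤ n, ∃ w₀, HasLargeLevels ξ n j F C c δ (κ · = κ w₀)

variable {F : List (Ordinal.{u} × D) → List (Ordinal.{u} × D) → ℝ} {C c δ : ℝ}
  {Φ Φ' : List (Ordinal.{u} × D) → Prop} {n j : ℕ}

theorem HasLargeLevels.mono (h : HasLargeLevels ξ n j F C c δ Φ)
    (hΦ : ∀ w ∈ maxElts (levelOmg ξ D n), Φ w → Φ' w) : HasLargeLevels ξ n j F C c δ Φ' where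
  large hj := (h.large hj).mono fun w hw _ _ _ hsw => ⟨hsw.1, hΦ w hw hsw.2⟩
  avg := h.avg.mono fun w hw _ _ _ hsw => ⟨hsw.1, hΦ w hw hsw.2⟩

theorem levelDichotomy_one [Nonempty D] (h : Dichotomy ξ D) : LevelDichotomy ξ D 1 := by
  intro F C hF c δ hδ K κ hκ
  have bound : ∀ b ∈ maxElts (Omg ξ D), wavg (ξ + 1) b (F · b) ≤ C := fun b hb =>
    wavg_add_one hb.1 (F · b) ▸ wavg_le_const hb fun s => (abs_le.1 (hF s b)).2
  rcases h F C hF c δ hδ with hl | hs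
  · obtain ⟨w₀, hw₀⟩ := h.exists_monochromatic hl hκ
    refine ⟨1, le_rfl, w₀, ?_, ?_⟩ <;> rw [levelOmg_one]
    · exact fun _ => hw₀
    · exact hw₀.mono fun b hb _ _ _ hsb => ⟨by simpa using bound b hb, hsb.2⟩
  · obtain ⟨w₀, hw₀⟩ := h.exists_monochromatic hs hκ
    refine ⟨0, zero_le_one, w₀, fun h0 => absurd h0 (lt_irrefl 0), ?_⟩
    rw [levelOmg_one]
    refine hw₀.mono fun b hb _ _ _ hsb => ⟨?_, hsb.2⟩
    rw [wavg_add_one hb.1]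
    simpa using hsb.1.le

theorem LevelDichotomy.exists_approx (h : LevelDichotomy ξ D n) (hF : ∀ s b, |F s b| ≤ C) (c : ℝ)
    (hδ : 0 < δ) {K I : Type max (u + 1) v} [Finite I] {κ : List (Ordinal.{u} × D) → K}
    (hκ : (Set.range κ).Finite) {φ : I → List (Ordinal.{u} × D) → ℝ} {M : ℝ}
    (hφ : ∀ i w, |φ i w| ≤ M) {η : ℝ} (hη : 0 < η) :
    ∃ j ≤ n, ∃ w₀, HasLargeLevels ξ n j F C c δ fun w =>
      κ w = κ w₀ ∧ ∀ i, |φ i w - φ i w₀| < η := by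
  let κ' : List (Ordinal.{u} × D) → K × (I → ℤ) := fun w => (κ w, fun i => ⌊φ i w / η⌋)
  have hκ' : (Set.range κ').Finite := by
    refine (hκ.prod (Set.Finite.pi' fun _ : I => Set.finite_Icc ⌊-M / η⌋ ⌊M / η⌋)).subset ?_
    rintro _ ⟨w, rfl⟩
    have hφ' (i : I) := abs_le.1 (hφ i w)
    exact ⟨⟨w, rfl⟩, fun i => ⟨Int.floor_mono (div_le_div_of_nonneg_right (hφ' i).1 hη.le),
      Int.floor_mono (div_le_div_of_nonneg_right (hφ' i).2 hη.le)⟩⟩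
  obtain ⟨j, hj, w₀, hw₀⟩ := h F C hF c δ hδ _ κ' hκ'
  refine ⟨j, hj, w₀, hw₀.mono fun w _ hw => ?_⟩
  obtain ⟨hκw, hφw⟩ := Prod.ext_iff.1 hw
  refine ⟨hκw, fun i => ?_⟩
  have hfloor := Int.abs_sub_lt_one_of_floor_eq_floor (congrFun hφw i)
  rwa [← sub_div, abs_div, abs_of_pos hη, div_lt_one hη] at hfloor

theorem prunes_wavg_levelOmg_succ [Nonempty D] (hn : 1 ≤ n) (P : PruneMap (Omg ξ D) (Omg ξ D))
    {x y : ℝ} (h : ∀ t ∈ maxElts (Omg ξ D), Prunes (levelOmg ξ D n) (levelOmg ξ D n) fun _ w =>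
      wavg ξ (P.e t)
          (fun s => F (shiftD (omega0 ^ ξ * n) s) (shiftD (omega0 ^ ξ * n) (P.e t) ++ w)) ≤ x ∧
        n * wavg (ξ + 1) w (fun r => F (shiftD (omega0 ^ ξ * n) (P.e t) ++ r)
          (shiftD (omega0 ^ ξ * n) (P.e t) ++ w)) ≤ y ∧
        Φ (shiftD (omega0 ^ ξ * n) (P.e t) ++ w)) :
    Prunes (levelOmg ξ D (n + 1)) (levelOmg ξ D (n + 1)) fun _ b =>
      (n + 1) * wavg (ξ + 1) b (F · b) ≤ x + y ∧ Φ b := by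
  rw [levelOmg_succ]
  refine Prunes.concat (isBelow_levelOmg ξ n) (isBelow_levelOmg ξ n)
    ((maxElts_levelOmg_nonempty ξ hn).mono fun _ => And.left) (maxElts_Omg_nonempty ξ) P
    fun t ht => (h t ht).mono fun w hw _ _ _ ⟨hx, hy, hΦ⟩ => ?_
  rw [wavg_shiftD_append (P.map_max t ht) hw.1]
  exact ⟨fun _ _ _ => ⟨add_le_add hx hy, hΦ⟩, add_le_add hx hy, hΦ⟩

theorem HasLargeLevels.concat_large [Nonempty D] (hn : 1 ≤ n) (hF : ∀ s b, F s b ≤ C)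
    (P : PruneMap (Omg ξ D) (Omg ξ D))
    (h : ∀ t ∈ maxElts (Omg ξ D), HasLargeLevels ξ n j
      (fun r w => F (shiftD (omega0 ^ ξ * n) (P.e t) ++ r)
        (shiftD (omega0 ^ ξ * n) (P.e t) ++ w)) C c δ
      fun w => (∀ s ∈ Omg ξ D, s <+: t → c - δ ≤ F (shiftD (omega0 ^ ξ * n) (P.θ s))
        (shiftD (omega0 ^ ξ * n) (P.e t) ++ w)) ∧ Φ (shiftD (omega0 ^ ξ * n) (P.e t) ++ w)) :
    HasLargeLevels ξ (n + 1) (j + 1) F C c δ Φ where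
  large _ := by
    rcases j.eq_zero_or_pos with rfl | hj
    · rw [zero_add, levelOmg_one, levelOmg_succ]
      refine Prunes.extend_branches Set.subset_union_left ((shiftMap _ _).comp P) fun t ht => ?_
      obtain ⟨w, hw, -, hlarge, hΦ⟩ := (h t ht).avg.exists_branch (maxElts_levelOmg_nonempty ξ hn)
      exact ⟨_, mem_maxElts_concatTree (isBelow_levelOmg ξ n) (P.map_max t ht) hw,
        List.prefix_append _ _, fun s hs hp => ⟨hlarge s hs hp, hΦ⟩⟩
    · rw [levelOmg_succ, levelOmg_succ]
      exact Prunes.concat (isBelow_levelOmg ξ j) (isBelow_levelOmg ξ n)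
        ((maxElts_levelOmg_nonempty ξ hj).mono fun _ => And.left) (maxElts_Omg_nonempty ξ) P
        fun t ht => ((h t ht).large hj).mono fun w _ r _ _ ⟨hr, hlarge, hΦ⟩ =>
          ⟨fun s hs hp => ⟨hlarge s hs hp, hΦ⟩, hr, hΦ⟩
  avg := by
    have hsum := prunes_wavg_levelOmg_succ hn P fun t ht => (h t ht).avg.mono fun w _ _ _ _ hw =>
      ⟨wavg_le_const (P.map_max t ht) fun s => hF _ _, hw.1, hw.2.2⟩
    exact hsum.mono fun b _ _ _ _ hb => ⟨by push_cast; linarith [hb.1], hb.2⟩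

theorem HasLargeLevels.concat_small [Nonempty D] (hn : 1 ≤ n)
    (P : PruneMap (Omg ξ D) (Omg ξ D))
    (h : ∀ t ∈ maxElts (Omg ξ D), HasLargeLevels ξ n j
      (fun r w => F (shiftD (omega0 ^ ξ * n) (P.e t) ++ r)
        (shiftD (omega0 ^ ξ * n) (P.e t) ++ w)) C c δ
      fun w => wavg ξ (P.e t) (fun s => F (shiftD (omega0 ^ ξ * n) s)
          (shiftD (omega0 ^ ξ * n) (P.e t) ++ w)) ≤ c ∧
        Φ (shiftD (omega0 ^ ξ * n) (P.e t) ++ w)) :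
    HasLargeLevels ξ (n + 1) j F C c δ Φ where
  large hj := by
    obtain ⟨t, ht⟩ := maxElts_Omg_nonempty (D := D) ξ
    rw [levelOmg_succ]
    exact .postcomp (.prepend (isBelow_levelOmg ξ n) (P.map_max t ht))
      (((h t ht).large hj).mono fun _ _ _ _ _ hrw => ⟨hrw.1, hrw.2.2⟩)
  avg := by
    have hsum := prunes_wavg_levelOmg_succ hn P fun t ht => (h t ht).avg.mono fun w _ _ _ _ hw =>
      ⟨hw.2.1, hw.1, hw.2.2⟩
    exact hsum.mono fun b _ _ _ _ hb => ⟨by push_cast; linarith [hb.1], hb.2⟩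

theorem LevelDichotomy.succ [Nonempty D] (hξ : Dichotomy ξ D) {n : ℕ} (hn : 1 ≤ n)
    (h : LevelDichotomy ξ D n) : LevelDichotomy ξ D (n + 1) := by
  intro F C hF c δ hδ K κ hκ
  let x (b : List (Ordinal.{u} × D)) := shiftD (omega0 ^ ξ * n) b
  have stage (b : List (Ordinal.{u} × D)) : ∃ j ≤ n, ∃ w₀, HasLargeLevels ξ n j
      (fun r w => F (x b ++ r) (x b ++ w)) C c δ fun w =>
        κ (x b ++ w) = κ (x b ++ w₀) ∧
          ∀ s : {s // s ∈ b.inits}, |F (x s) (x b ++ w) - F (x s) (x b ++ w₀)| < δ / 3 :=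
    have : Finite {s // s ∈ b.inits} := List.finite_toSet b.inits
    h.exists_approx (fun _ _ => hF _ _) c hδ (hκ.subset (Set.range_comp_subset_range (x b ++ ·) κ))
      (fun _ _ => hF _ _) (by positivity)
  choose j hj w₀ hw₀ using stage
  have color : (Set.range fun b => (j b, κ (x b ++ w₀ b))).Finite := by
    refine ((Set.finite_Iic n).prod hκ).subset ?_
    rintro _ ⟨b, rfl⟩
    exact ⟨hj b, _, rfl⟩
  have close {b w s} (hs : s <+: b) (hw : ∀ s : {s // s ∈ b.inits},
      |F (x s) (x b ++ w) - F (x s) (x b ++ w₀ b)| < δ / 3) :=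
    abs_lt.1 (hw ⟨s, (List.mem_inits s b).2 hs⟩)
  rcases hξ (fun s b => F (x s) (x b ++ w₀ b)) C (fun _ _ => hF _ _) (c - δ / 3) (δ / 3)
    (by positivity) with hl | hs
  · obtain ⟨b₀, P, hP⟩ := hξ.exists_monochromatic hl color
    refine ⟨j b₀ + 1, by simpa using hj b₀, x b₀ ++ w₀ b₀, ?_⟩
    refine HasLargeLevels.concat_large hn (fun s b => (abs_le.1 (hF s b)).2) P fun t ht => ?_
    obtain ⟨hjt, hκt⟩ := Prod.mk.inj (hP t ht t ht.1 List.prefix_rfl).2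
    refine hjt ▸ (hw₀ (P.e t)).mono fun w _ hw => ⟨fun s hs hp => ?_, hw.1.trans hκt⟩
    linarith [(hP t ht s hs hp).1, (close (P.prefix_max hs ht hp) hw.2).1]
  · obtain ⟨b₀, P, hP⟩ := hξ.exists_monochromatic hs color
    refine ⟨j b₀, (hj b₀).trans n.le_succ, x b₀ ++ w₀ b₀, ?_⟩
    refine HasLargeLevels.concat_small hn P fun t ht => ?_
    obtain ⟨hlt, heq⟩ := hP t ht t ht.1 List.prefix_rfl
    obtain ⟨hjt, hκt⟩ := Prod.mk.inj heq
    refine hjt ▸ (hw₀ (P.e t)).mono fun w _ hw => ⟨?_, hw.1.trans hκt⟩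
    have havg : wavg ξ (P.e t) (fun s => F (x s) (x (P.e t) ++ w)) ≤
        wavg ξ (P.e t) (fun s => F (x s) (x (P.e t) ++ w₀ (P.e t))) + δ / 3 :=
      wavg_le_of_approx (P.map_max t ht) fun s _ hp => by linarith [(close hp hw.2).2]
    exact havg.trans (by linarith)

theorem levelDichotomy [Nonempty D] (hξ : Dichotomy ξ D) {n : ℕ} (hn : 1 ≤ n) :
    LevelDichotomy ξ D n := by
  induction n, hn using Nat.le_induction with
  | base => exact levelDichotomy_one hξ
  | succ n hn ih => exact ih.succ hξ hn

/-- The pruning of `Ω_0` defined by an expansive map of `D`. -/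
def zeroMap (φ : D → D) (hφ : ∀ d, d ≤ φ d) :
    PruneMap (Omg (0 : Ordinal.{u}) D) (Omg (0 : Ordinal.{u}) D) where
  θ := List.map (Prod.map id φ)
  e := List.map (Prod.map id φ)
  map_mem τ h := by
    obtain ⟨d, rfl⟩ := exists_of_mem_Omg_zero h
    exact (singleton_mem_maxElts_Omg_zero _).1
  map_max τ h := by
    obtain ⟨d, rfl⟩ := exists_of_mem_Omg_zero h.1
    exact singleton_mem_maxElts_Omg_zero _
  mono τ h τ' h' hp hne := by
    obtain ⟨d, rfl⟩ := exists_of_mem_Omg_zero h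
    obtain ⟨d', rfl⟩ := exists_of_mem_Omg_zero h'
    exact absurd (by simpa using hp) hne
  le_last τ h x hx := by
    obtain ⟨d, rfl⟩ := exists_of_mem_Omg_zero h
    obtain rfl : (0, d) = x := by simpa using hx
    exact ⟨(0, φ d), by simp, hφ d⟩
  prefix_e _ _ := List.prefix_rfl

theorem dichotomy_zero [IsDirectedOrder D] : Dichotomy (0 : Ordinal.{u}) D := by
  intro F C _ c δ hδ
  by_cases h : ∃ d, ∀ d', d ≤ d' → c ≤ F [(0, d')] [(0, d')]
  · obtain ⟨d, hd⟩ := h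
    choose φ hdφ hφ using fun d' => directed_of (· ≤ ·) d d'
    refine Or.inl ⟨zeroMap φ hφ, fun τ hτ s hs hp => ?_⟩
    obtain ⟨d₁, rfl⟩ := exists_of_mem_Omg_zero hs
    obtain ⟨d₂, rfl⟩ := exists_of_mem_Omg_zero hτ.1
    obtain rfl : d₁ = d₂ := by simpa using hp
    exact (sub_lt_self c hδ).le.trans (hd _ (hdφ d₁))
  · push Not at h
    choose φ hφ hlt using h
    refine Or.inr ⟨zeroMap φ hφ, fun τ hτ _ _ _ => ?_⟩
    obtain ⟨d, rfl⟩ := exists_of_mem_Omg_zero hτ.1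
    simpa [zeroMap, wavg, prob_zero] using hlt d

theorem dichotomy_limit (hξ : Order.IsSuccLimit ξ) (ih : ∀ ζ < ξ, Dichotomy (ζ + 1) D) :
    Dichotomy ξ D := by
  intro F C hF c δ hδ
  refine (isComponents_limit hξ).prunes_or_prunes (fun ζ η hζη => ?_) fun ζ => ?_
  · obtain ⟨P⟩ := nonempty_pruneMap_Omg (D := D) (show ζ.1 + 1 ≤ η.1 + 1 by gcongr)
    exact ⟨(shiftMap _ _).comp (P.comp (unshiftMap _ _))⟩
  · let Q := ((isComponents_limit hξ).incl ζ).comp (shiftMap (omega0 ^ ζ.1) (Omg (ζ.1 + 1) D))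
    refine (ih ζ ζ.2 (fun s b => F (Q.θ s) (Q.e b)) C (fun _ _ => hF _ _) c δ hδ).imp
      (fun hl => (hl.postcomp Q).precomp (unshiftMap _ _))
      fun hs => .precomp (.postcomp Q (hs.mono fun b hb _ _ _ hlt => ?_)) (unshiftMap _ _)
    exact (wavg_limit hξ ζ.2 hb.1 _).trans_lt hlt

theorem exists_forall_mul_add_lt (C c : ℝ) {δ : ℝ} (hδ : 0 < δ) (k : ℕ) :
    ∃ N : ℕ, ∀ n ≥ N, ∀ j ≤ k, j * C + (n - j) * (c - δ) < n * c := by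
  obtain ⟨N, hN⟩ := exists_nat_gt (k * |C - (c - δ)| / δ)
  rw [div_lt_iff₀ hδ] at hN
  refine ⟨N, fun n hn j hj => ?_⟩
  have : j * (C - (c - δ)) < n * δ := calc
    j * (C - (c - δ)) ≤ j * |C - (c - δ)| :=
      mul_le_mul_of_nonneg_left (le_abs_self _) (Nat.cast_nonneg j)
    _ ≤ k * |C - (c - δ)| := by gcongr
    _ < N * δ := hN
    _ ≤ n * δ := by gcongr
  linarith

theorem dichotomy_add_one [Nonempty D] (hξ : Dichotomy ξ D) : Dichotomy (ξ + 1) D := by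
  intro F C hF c δ hδ
  have hcomp := isComponents_add_one (D := D) ξ
  have emb (m n : ℕ) (h : m ≤ n) := nonempty_pruneMap_levelOmg (D := D) ξ h
  have levels (n : ℕ) (hn : 1 ≤ n) : ∃ j,
      HasLargeLevels ξ n j F C (c - δ / 2) (δ / 2) fun _ => True := by
    obtain ⟨j, -, -, hlev⟩ := levelDichotomy hξ hn F C hF (c - δ / 2) (δ / 2) (half_pos hδ) _
      (fun _ => PUnit.unit) (Set.toFinite _)
    exact ⟨j, hlev.mono fun _ _ _ => trivial⟩
  choose! j hlev using levels
  by_cases hunb : ∀ k, ∃ n, 1 ≤ n ∧ k < j n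
  · refine Or.inl (hcomp.prunes_of_cofinal emb fun k => ?_)
    obtain ⟨n, hn, hk⟩ := hunb k
    refine ⟨j n, hk.le, .postcomp (hcomp.incl n) (((hlev n hn).large (by omega)).mono ?_)⟩
    intro b _ s _ _ hsb
    have : c - δ / 2 - δ / 2 ≤ F s b := hsb.1
    exact (by linarith : c - δ ≤ F s b)
  · push Not at hunb
    obtain ⟨k, hk⟩ := hunb
    refine Or.inr (hcomp.prunes_of_cofinal emb fun i => ?_)
    obtain ⟨N, hN⟩ := exists_forall_mul_add_lt C c (half_pos hδ) k
    let n := max i (max N 1)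
    have hn : 1 ≤ n := by omega
    refine ⟨n, by omega, .postcomp (hcomp.incl n) ((hlev n hn).avg.mono fun b _ _ _ _ hb => ?_)⟩
    exact lt_of_mul_lt_mul_left (hb.1.trans_lt (hN n (by omega) _ (hk n hn))) (Nat.cast_nonneg n)

theorem dichotomy [Nonempty D] [IsDirectedOrder D] (ξ : Ordinal.{u}) : Dichotomy ξ D := by
  induction ξ using Ordinal.limitRecOn with
  | zero => exact dichotomy_zero
  | add_one ξ ih => exact dichotomy_add_one ih
  | limit ξ hξ ih => exact dichotomy_limit hξ fun ζ hζ => ih _ (hξ.add_one_lt hζ)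

end Dichotomy

section Conclusion

variable {ξ : Ordinal.{u}} {D : Type v}

theorem branchAvg_eq_wavg {g : branchPairs (Omg ξ D) → ℝ}
    {F : List (Ordinal.{u} × D) → List (Ordinal.{u} × D) → ℝ} (hF : ∀ q, F q.1.1 q.1.2 = g q)
    (τ : maxElts (Omg ξ D)) : branchAvg g τ = wavg ξ τ.1 (F · τ.1) := by
  rw [wavg, branchAvg, ← Fin.sum_univ_eq_sum_range
    (fun i => prob ξ ((τ.1.take (i + 1)).map Prod.fst) * F (τ.1.take (i + 1)) τ.1)]
  exact Finset.sum_congr rfl fun i _ => by rw [← hF (initPair τ i)]; rfl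

theorem branchAvg_mono {g g' : branchPairs (Omg ξ D) → ℝ} (h : g ≤ g') (τ : maxElts (Omg ξ D)) :
    branchAvg g τ ≤ branchAvg g' τ :=
  Finset.sum_le_sum fun i _ => mul_le_mul_of_nonneg_left (h (initPair τ i)) (prob_nonneg _ _)

theorem Prunes.exists_extPruning {Λ₁ Λ₂ : Type*} [Preorder D] {S₁ : Set (List (Λ₁ × D))}
    {S₂ : Set (List (Λ₂ × D))} {Ψ : List (Λ₂ × D) → List (Λ₂ × D) → Prop}
    (h : Prunes S₁ S₂ Ψ) :
    ∃ P : ExtPruning S₁ S₂, ∀ q, Ψ (P.mapPair q).1.1 (P.mapPair q).1.2 := by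
  obtain ⟨P, hP⟩ := h
  exact ⟨P.toExtPruning, fun q => hP q.1.2 q.2.2.1 q.1.1 q.2.1 q.2.2.2⟩

variable [Preorder D] {g : branchPairs (Omg ξ D) → ℝ} {ε : ℝ}

theorem exists_sub_le_mapPair_or_isSmall_of_abs_le [Nonempty D] [IsDirectedOrder D] {C : ℝ}
    (hC : ∀ q, |g q| ≤ C) (ε : ℝ) {δ : ℝ} (hδ : 0 < δ) :
    (∃ P : ExtPruning (Omg ξ D) (Omg ξ D), ∀ q, ε - δ ≤ g (P.mapPair q)) ∨ IsSmall g ε := by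
  let F (s b : List (Ordinal.{u} × D)) : ℝ := Function.extend Subtype.val g 0 (s, b)
  have hFg (q) : F q.1.1 q.1.2 = g q := Subtype.val_injective.extend_apply g 0 q
  have hF (s b) : |F s b| ≤ max C 0 := by
    by_cases h : ∃ q : branchPairs (Omg ξ D), q.1 = (s, b)
    · obtain ⟨q, hq⟩ := h
      obtain ⟨rfl, rfl⟩ := Prod.mk.inj hq
      exact hFg q ▸ le_max_of_le_left (hC q)
    · simp [F, Function.extend_apply' _ _ _ h]
  refine (dichotomy ξ F _ hF ε δ hδ).imp (fun hl => ?_) fun hs => ?_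
  · obtain ⟨P, hP⟩ := hl.exists_extPruning
    exact ⟨P, fun q => hFg (P.mapPair q) ▸ hP q⟩
  · obtain ⟨P, hP⟩ := hs.exists_extPruning
    refine ⟨P, fun τ => ?_⟩
    rw [branchAvg_eq_wavg hFg]
    exact hP ⟨(τ.1, τ.1), τ.2.1, τ.2, List.prefix_rfl⟩

theorem exists_sub_le_mapPair_or_isSmall [Nonempty D] [IsDirectedOrder D] {C : ℝ}
    (hC : ∀ q, g q ≤ C) (ε : ℝ) {δ : ℝ} (hδ : 0 < δ) :
    (∃ P : ExtPruning (Omg ξ D) (Omg ξ D), ∀ q, ε - δ ≤ g (P.mapPair q)) ∨ IsSmall g ε := by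
  -- Raising `g` to `ε - δ - 1` where it is smaller does not affect whether `ε - δ ≤ g`.
  let g' (q) := max (g q) (ε - δ - 1)
  have hg' (q) : |g' q| ≤ max |C| |ε - δ - 1| := by
    rw [abs_le]
    refine ⟨neg_le.1 ?_, max_le_max ((hC q).trans (le_abs_self C)) (le_abs_self _)⟩
    exact (neg_le_neg (le_max_right _ _)).trans ((neg_le_abs _).trans (le_max_right _ _))
  refine (exists_sub_le_mapPair_or_isSmall_of_abs_le hg' ε hδ).imp ?_ ?_
  · rintro ⟨P, hP⟩
    exact ⟨P, fun q => (le_max_iff.1 (hP q)).resolve_right (by linarith)⟩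
  · rintro ⟨P, hP⟩
    exact ⟨P, fun τ => (branchAvg_mono (fun q => le_max_left _ _) _).trans_lt (hP τ)⟩

theorem isLarge_of_isEmpty [IsEmpty D] (g : branchPairs (Omg ξ D) → ℝ) (ε : ℝ) : IsLarge g ε := by
  intro δ _
  refine ⟨(PruneMap.refl _).toExtPruning, fun q => ?_⟩
  obtain ⟨τ, hτ⟩ := q
  obtain ⟨x, -, -⟩ := List.exists_cons_of_ne_nil (ne_of_mem_of_not_mem hτ.1 (isBTree_Omg ξ D).1)
  exact isEmptyElim x.2

theorem isLarge_or_isSmall [IsDirectedOrder D] {C : ℝ} (hC : ∀ q, g q ≤ C) (ε : ℝ) :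
    IsLarge g ε ∨ IsSmall g ε := by
  cases isEmpty_or_nonempty D
  · exact Or.inl (isLarge_of_isEmpty g ε)
  · by_cases hs : IsSmall g ε
    · exact Or.inr hs
    · exact Or.inl fun δ hδ => (exists_sub_le_mapPair_or_isSmall hC ε hδ).resolve_right hs

theorem isLarge_of_le_branchAvg [IsDirectedOrder D] {C : ℝ} (hC : ∀ q, g q ≤ C)
    (h : ∀ τ : maxElts (Omg ξ D), ε ≤ branchAvg g τ) : IsLarge g ε := by
  cases isEmpty_or_nonempty D
  · exact isLarge_of_isEmpty g ε
  · refine (isLarge_or_isSmall hC ε).resolve_right ?_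
    rintro ⟨P, hP⟩
    obtain ⟨τ, hτ⟩ := maxElts_Omg_nonempty (D := D) ξ
    exact (hP ⟨τ, hτ⟩).not_ge (h _)

end Conclusion

end OrdTree

theorem mainTheorem8_general (ξ : Ordinal.{u}) (D : Type v) [Preorder D] [IsDirectedOrder D]
    (g : OrdTree.branchPairs (OrdTree.Omg ξ D) → ℝ) {C : ℝ} (hC : ∀ q, g q ≤ C) (ε : ℝ) :
    (OrdTree.IsLarge g ε ∨ OrdTree.IsSmall g ε) ∧
      ((∀ τ : OrdTree.maxElts (OrdTree.Omg ξ D), ε ≤ OrdTree.branchAvg g τ) →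
        OrdTree.IsLarge g ε) :=
  ⟨OrdTree.isLarge_or_isSmall hC ε, OrdTree.isLarge_of_le_branchAvg hC⟩

theorem mainTheorem8 (ξ : Ordinal.{u}) (D : Type v) [Preorder D] [IsDirectedOrder D] :
    (∀ g : OrdTree.branchPairs (OrdTree.Omg ξ D) → ℝ, (∀ q, g q ∈ Set.Icc (-1 : ℝ) 1) →
      ∀ ε : ℝ, OrdTree.IsLarge g ε ∨ OrdTree.IsSmall g ε) ∧
    (∀ g : OrdTree.branchPairs (OrdTree.Omg ξ D) → ℝ, (∃ C : ℝ, ∀ q, |g q| ≤ C) →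
      ∀ ε : ℝ, (∀ τ : OrdTree.maxElts (OrdTree.Omg ξ D), ε ≤ OrdTree.branchAvg g τ) →
        OrdTree.IsLarge g ε) :=
  ⟨fun g hg ε => (mainTheorem8_general ξ D g (fun q => (hg q).2) ε).1,
    fun g ⟨_, hC⟩ ε => (mainTheorem8_general ξ D g (fun q => (abs_le.1 (hC q)).2) ε).2⟩
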